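/- Let $\alpha>-1$ and $\alpha+\beta>-1/2$ be real numbers. For $\nu\in\mathbb{R}$ let $J_\nu$ be the Bessel function of the first kind of order $\nu$, and let $d\mu_\alpha(y)=y^{2\alpha+1}\,dy$ on $(0,\infty)$. For suitable $f\colon(0,\infty)\to\mathbb{C}$ let $$\mathcal{H}_\alpha f(x)=\int_0^\infty f(y)\,\frac{J_\alpha(xy)}{(xy)^\alpha}\,d\mu_\alpha(y),\qquad x>0,$$ be the (modified) Hankel transform, and for $t>0$ set $$\mathcal{M}_t^{\alpha,\beta}f=\mathcal{H}_\alpha\big(m_{\alpha,\beta}(t\,\cdot)\,\mathcal{H}_\alpha f\big),\qquad m_{\alpha,\beta}(s)=2^{\alpha+\beta}\Gamma(\alpha+\beta+1)\frac{J_{\alpha+\beta}(s)}{s^{\alpha+\beta}},\quad s>0.$$ Define the kernel $$K_t^{\alpha,\beta}(x,z)=2^{\alpha+\beta}\Gamma(\alpha+\beta+1)\int_0^\infty\frac{J_{\alpha+\beta}(ty)}{(ty)^{\alpha+\beta}}\,\frac{J_\alpha(xy)}{(xy)^\alpha}\,\frac{J_\alpha(zy)}{(zy)^\alpha}\,d\mu_\alpha(y),\qquad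 t,x,z>0,$$ where the integral is understood as $\lim_{N\to\infty}\int_0^N$ (it may converge only conditionally at infinity), and the integral operator $$M_t^{\alpha,\beta}f(x)=\int_0^\infty K_t^{\alpha,\beta}(x,z)f(z)\,d\mu_\alpha(z),$$ whose natural domain $\operatorname{Dom}M_t^{\alpha,\beta}$ consists of all $f$ such that for almost all $x>0$ the kernel $K_t^{\alpha,\beta}(x,z)$ is given by a convergent integral for almost all $z>0$ and the integral defining $M_t^{\alpha,\beta}f(x)$ converges absolutely. Then, for each $t>0$, $C_c^\infty(0,\infty)\subset\operatorname{Dom}M_t^{\alpha,\beta}$. Moreover, for every $f\in C_c^\infty(0,\infty)$ both Hankel transforms in the definition of $\mathcal{M}_t^{\alpha,\beta}f$ are given by integrals that converge absolutely at every point of $(0,\infty)$, and for every $x>0$ the kernel $K_t^{\alpha,\beta}(x,z)$ is given by a convergent integral for almost all $z>0$, the integral defining $M_t^{\alpha,\beta}f(x)$ converges absolutely, and $$\mathcal{M}_t^{\alpha,\beta}f(x)=M_t^{\alpha,\beta}f(x).$$ -/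

import Mathlib

open MeasureTheory Set Filter Topology
open scoped ContDiff

namespace SphericalMeans

noncomputable section

/-- The Bessel function of the first kind `J_ν(x)` for real order `ν` and argument `x > 0`, by its
power series. (`Real.Gamma` vanishes at its poles, so that the corresponding terms are zero, which
is the usual convention `1 / Γ(-n) = 0`.) -/
def besselJ (ν x : ℝ) : ℝ :=
  ∑' k : ℕ, (-1 : ℝ) ^ k / ((k.factorial : ℝ) * Real.Gamma ((k : ℝ) + ν + 1)) *
    (x / 2) ^ (2 * (k : ℝ) + ν)

/-- `J_ν(u) / u^ν` for `u > 0`. -/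
def besselQuot (ν u : ℝ) : ℝ := besselJ ν u / u ^ ν

/-- The measure `dμ_α(y) = y^(2α+1) dy` on the half-line `(0, ∞)`, as a measure on `ℝ`. -/
def mu (α : ℝ) : Measure ℝ :=
  (volume.restrict (Ioi (0 : ℝ))).withDensity (fun y => ENNReal.ofReal (y ^ (2 * α + 1)))

/-- The class `C_c^∞(0, ∞)`, its elements being extended by `0` to the whole line. -/
def IsTestFunction (f : ℝ → ℂ) : Prop :=
  ContDiff ℝ ∞ f ∧ HasCompactSupport f ∧ tsupport f ⊆ Ioi (0 : ℝ)

/-- The (modified) Hankel transform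
`H_α f(x) = ∫_0^∞ f(y) J_α(xy) / (xy)^α dμ_α(y)`. -/
def hankel (α : ℝ) (f : ℝ → ℂ) (x : ℝ) : ℂ :=
  ∫ y, besselQuot α (x * y) • f y ∂(mu α)

/-- The integral defining `H_α f(x)` converges absolutely for every `x > 0`. -/
def HankelConverges (α : ℝ) (f : ℝ → ℂ) : Prop :=
  ∀ x : ℝ, 0 < x → Integrable (fun y => besselQuot α (x * y) • f y) (mu α)

/-- The multiplier `m_{α,β}(s) = 2^(α+β) Γ(α+β+1) J_{α+β}(s) / s^(α+β)`, `s > 0`. -/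
def multiplier (α β s : ℝ) : ℝ :=
  (2 : ℝ) ^ (α + β) * Real.Gamma (α + β + 1) * besselQuot (α + β) s

/-- The function `y ↦ m_{α,β}(t y) H_α f(y)`. -/
def multHankel (α β t : ℝ) (f : ℝ → ℂ) (y : ℝ) : ℂ :=
  multiplier α β (t * y) • hankel α f y

/-- The Hankel multiplier operator `f ↦ H_α (m_{α,β}(t ·) H_α f)`. -/
def meanMultiplier (α β t : ℝ) (f : ℝ → ℂ) : ℝ → ℂ :=
  hankel α (multHankel α β t f)

/-- The product of three Bessel functions in the kernel. -/
def tripleBessel (α β t x z y : ℝ) : ℝ :=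
  besselQuot (α + β) (t * y) * besselQuot α (x * y) * besselQuot α (z * y)

/-- The integral over `(0, ∞)` of the triple product against `μ_α` converges to `l`, possibly only
conditionally at `∞` (in the Riemann sense): it is absolutely convergent on each `(0, N]`, and the
integrals over `(0, N]` tend to `l` as `N → ∞`. -/
def HasTripleIntegral (α β t x z l : ℝ) : Prop :=
  (∀ N : ℝ, IntegrableOn (tripleBessel α β t x z) (Ioc 0 N) (mu α)) ∧
    Tendsto (fun N : ℝ => ∫ y in Ioc 0 N, tripleBessel α β t x z y ∂(mu α)) atTop (𝓝 l)

/-- The kernel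
`K_t(x,z) = 2^(α+β) Γ(α+β+1) ∫_0^∞ J_{α+β}(ty)/(ty)^(α+β) J_α(xy)/(xy)^α J_α(zy)/(zy)^α dμ_α(y)`,
the integral being understood as `lim_{N → ∞} ∫_0^N`. The value is arbitrary where the integral
does not converge. -/
def kernel (α β t x z : ℝ) : ℝ :=
  (2 : ℝ) ^ (α + β) * Real.Gamma (α + β + 1) *
    limUnder atTop (fun N : ℝ => ∫ y in Ioc 0 N, tripleBessel α β t x z y ∂(mu α))

/-- The integral operator `M_t f(x) = ∫_0^∞ K_t(x,z) f(z) dμ_α(z)`. -/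
def meanIntegral (α β t : ℝ) (f : ℝ → ℂ) (x : ℝ) : ℂ :=
  ∫ z, kernel α β t x z • f z ∂(mu α)

/-- The integral defining `M_t f(x)` makes sense and converges absolutely: the kernel `K_t(x,z)` is
given by a convergent integral for almost all `z > 0`, and `z ↦ K_t(x,z) f(z)` is integrable. -/
def MeanConvergesAt (α β t : ℝ) (f : ℝ → ℂ) (x : ℝ) : Prop :=
  (∀ᵐ z ∂(volume.restrict (Ioi (0 : ℝ))), ∃ l : ℝ, HasTripleIntegral α β t x z l) ∧
    Integrable (fun z => kernel α β t x z • f z) (mu α)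

/-- The natural domain of the integral operator `M_t`: the functions for which the defining
integral converges absolutely for almost all `x > 0`. -/
def domain (α β t : ℝ) : Set (ℝ → ℂ) :=
  {f | ∀ᵐ x ∂(volume.restrict (Ioi (0 : ℝ))), MeanConvergesAt α β t f x}

end

end SphericalMeans

/-! The function `J_ν(u) / u^ν` is the restriction to `u > 0` of an even entire function, here
`besselEntire ν`, whose power series gives `j_ν' = -u j_{ν+1}` and a three-term recurrence. Hence
`w(u) = u^(1/2) J_ν(u)` solves `w'' + w = (ν² - 1/4) w / u²`. An energy estimate bounds `w`, and
variation of constants turns the bound into the asymptotics `w(u) = R cos (u + φ) + O(u⁻¹)`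
(`exists_besselWave_asymptotic`).

For the kernel, put `δ = α + β + 1/2 > 0`. For large `y` the integrand against `dy` is `y^(-δ)`
times a product of three functions `w`. By the asymptotics it is the sum of an absolutely
integrable error `O(y^(-δ-1))` and of four terms `y^(-δ) cos (l y + φ)` with `l = t ± x ± z`. The
integrals of the latter converge whenever `l ≠ 0`, and their truncations are `O(|l|^(θ-1))` for some
`θ > 0`, uniformly in the truncation (`exists_oscillatory_bound`). So, for fixed `t` and `x`, the
kernel is given by a convergent integral for all `z` but finitely many, and its truncations are
dominated by a locally integrable function of `z` (`exists_truncatedTriple_bound`).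

For a test function `f`, one integration by parts shows `H_α f(y) = O(y^(-α-3/2))`
(`exists_hankelEntire_bound`), which makes the integrand of the outer Hankel transform
`O(y^(-δ-1))`, hence integrable. The outer integral over `(0, N]` equals, by Fubini's theorem, the
integral of `f` against the truncated kernel (`setIntegral_outerIntegrand`), and dominated
convergence as `N → ∞` identifies the two operators. -/

namespace SphericalMeans

/-! ### The entire function `J_ν(u) / u^ν` -/

/-- The coefficient of `s ^ k` in the power series of `J_ν(u) / u^ν` in the variable `s = u ^ 2`. -/
noncomputable def besselCoeff (ν : ℝ) (k : ℕ) : ℝ :=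
  (-1 : ℝ) ^ k / ((k.factorial : ℝ) * Real.Gamma ((k : ℝ) + ν + 1)) / (4 ^ k * (2 : ℝ) ^ ν)

/-- `J_ν(√s) / √s^ν` as an everywhere convergent power series in `s`. -/
noncomputable def besselSeries (ν s : ℝ) : ℝ := ∑' k : ℕ, besselCoeff ν k * s ^ k

/-- The even entire extension of `u ↦ J_ν(u) / u^ν` to the whole real line. -/
noncomputable def besselEntire (ν u : ℝ) : ℝ := besselSeries ν (u ^ 2)

lemma besselCoeff_succ {ν : ℝ} (hν : -1 < ν) (k : ℕ) :
    besselCoeff ν (k + 1) = -besselCoeff ν k / (4 * ((k : ℝ) + 1) * ((k : ℝ) + ν + 1)) := by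
  have h1 : (0 : ℝ) < (k : ℝ) + ν + 1 := by
    have : (0 : ℝ) ≤ k := Nat.cast_nonneg k
    linarith
  have hG := (Real.Gamma_pos_of_pos h1).ne'
  have h2 : (0 : ℝ) < (2 : ℝ) ^ ν := by positivity
  have e : ((k + 1 : ℕ) : ℝ) + ν + 1 = ((k : ℝ) + ν + 1) + 1 := by push_cast; ring
  unfold besselCoeff
  rw [e, Real.Gamma_add_one h1.ne', Nat.factorial_succ, pow_succ, pow_succ]
  push_cast
  field_simp

lemma besselCoeff_succ_mul {ν : ℝ} (hν : -1 < ν) (k : ℕ) :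
    besselCoeff ν (k + 1) * ((k : ℝ) + 1) = -(1 / 2) * besselCoeff (ν + 1) k := by
  have h1 : (0 : ℝ) < (k : ℝ) + ν + 1 := by
    have : (0 : ℝ) ≤ k := Nat.cast_nonneg k
    linarith
  have hG := (Real.Gamma_pos_of_pos h1).ne'
  have h2 : (0 : ℝ) < (2 : ℝ) ^ ν := by positivity
  rw [besselCoeff_succ hν]
  have e : (k : ℝ) + (ν + 1) + 1 = ((k : ℝ) + ν + 1) + 1 := by ring
  unfold besselCoeff
  rw [e, Real.Gamma_add_one h1.ne', Real.rpow_add two_pos, Real.rpow_one]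
  field_simp
  norm_num

lemma abs_besselCoeff_le {ν : ℝ} (hν : -1 < ν) (k : ℕ) :
    |besselCoeff ν k| ≤ |besselCoeff ν 0| * ((1 / (4 * (ν + 1))) ^ k / k.factorial) := by
  have h0 : 0 < ν + 1 := by linarith
  induction k with
  | zero => simp
  | succ k ih =>
    have hk : (0 : ℝ) ≤ k := Nat.cast_nonneg k
    rw [besselCoeff_succ hν, abs_div, abs_neg,
      abs_of_pos (show (0 : ℝ) < 4 * ((k : ℝ) + 1) * ((k : ℝ) + ν + 1) by
        have : 0 < (k : ℝ) + ν + 1 := by linarith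
        positivity)]
    calc |besselCoeff ν k| / (4 * ((k : ℝ) + 1) * ((k : ℝ) + ν + 1))
        ≤ (|besselCoeff ν 0| * ((1 / (4 * (ν + 1))) ^ k / k.factorial)) /
          (4 * ((k : ℝ) + 1) * (ν + 1)) := by
          gcongr
          linarith
      _ = _ := by
          rw [Nat.factorial_succ, pow_succ]
          push_cast
          field_simp

lemma summable_besselCoeff {ν : ℝ} (hν : -1 < ν) (s : ℝ) :
    Summable fun k : ℕ => besselCoeff ν k * s ^ k := by
  refine Summable.of_norm_bounded
    (g := fun k : ℕ => |besselCoeff ν 0| * ((1 / (4 * (ν + 1)) * |s|) ^ k / k.factorial))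
    ((Real.summable_pow_div_factorial _).mul_left _) fun k => ?_
  rw [norm_mul, norm_pow, Real.norm_eq_abs, Real.norm_eq_abs, mul_pow]
  calc _ ≤ |besselCoeff ν 0| * ((1 / (4 * (ν + 1))) ^ k / k.factorial) * |s| ^ k := by
        gcongr
        exact abs_besselCoeff_le hν k
    _ = _ := by ring

lemma hasDerivAt_besselSeries {ν : ℝ} (hν : -1 < ν) (s : ℝ) :
    HasDerivAt (besselSeries ν) (-(1 / 2) * besselSeries (ν + 1) s) s := by
  have hs : Summable fun k : ℕ => besselCoeff (ν + 1) k * s ^ k :=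
    summable_besselCoeff (by linarith) s
  set R := |s| + 1
  -- the summand of index `0` is constant and is split off before differentiating termwise
  have e : besselSeries ν = fun s => besselCoeff ν 0 +
      ∑' k : ℕ, besselCoeff ν (k + 1) * s ^ (k + 1) := by
    funext s
    rw [besselSeries, (summable_besselCoeff hν s).tsum_eq_zero_add]
    simp
  have hu : Summable fun k : ℕ => 1 / 2 * |besselCoeff (ν + 1) k * R ^ k| :=
    ((summable_besselCoeff (by linarith) R).abs).mul_left _
  have key := hasDerivAt_tsum_of_isPreconnected (𝕜 := ℝ) (F := ℝ) (t := Metric.ball 0 R)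
    (g := fun (k : ℕ) s => besselCoeff ν (k + 1) * s ^ (k + 1))
    (g' := fun k s => -(1 / 2) * (besselCoeff (ν + 1) k * s ^ k)) (y₀ := 0) (y := s)
    hu Metric.isOpen_ball (convex_ball _ _).isPreconnected ?_ ?_ ?_ ?_ ?_
  · rw [e]
    have := key.const_add (besselCoeff ν 0)
    rwa [tsum_mul_left] at this
  · intro k y _
    have h := (hasDerivAt_pow (k + 1) y).const_mul (besselCoeff ν (k + 1))
    refine h.congr_deriv ?_
    have := besselCoeff_succ_mul hν k
    rw [Nat.add_sub_cancel]
    push_cast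
    linear_combination y ^ k * this
  · intro k y hy
    rw [mem_ball_zero_iff, Real.norm_eq_abs] at hy
    rw [Real.norm_eq_abs, abs_mul, abs_mul, abs_mul, abs_pow, abs_pow, abs_neg,
      abs_of_pos (show (0 : ℝ) < 1 / 2 by norm_num), abs_of_pos (show 0 < R by positivity)]
    gcongr
  · exact Metric.mem_ball_self (by positivity)
  · simp
  · rw [mem_ball_zero_iff, Real.norm_eq_abs]
    simp [R]

lemma besselSeries_recurrence {ν : ℝ} (hν : -1 < ν) (s : ℝ) :
    besselSeries ν s =
      2 * (ν + 1) * besselSeries (ν + 1) s - s * besselSeries (ν + 2) s := by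
  have h0 := summable_besselCoeff hν s
  have h1 := summable_besselCoeff (show -1 < ν + 1 by linarith) s
  have h2 := summable_besselCoeff (show -1 < ν + 2 by linarith) s
  have hc (k : ℕ) : besselCoeff ν k = 2 * ((k : ℝ) + ν + 1) * besselCoeff (ν + 1) k := by
    have hk : (0 : ℝ) ≤ k := Nat.cast_nonneg k
    have a := besselCoeff_succ hν k
    have b := besselCoeff_succ_mul hν k
    have h3 : (k : ℝ) + ν + 1 ≠ 0 := by linarith
    have h4 : (k : ℝ) + 1 ≠ 0 := by linarith
    rw [a] at b
    field_simp at b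
    linarith
  have e : besselSeries ν s - 2 * (ν + 1) * besselSeries (ν + 1) s =
      ∑' k : ℕ, 2 * (k : ℝ) * besselCoeff (ν + 1) k * s ^ k := by
    unfold besselSeries
    rw [← tsum_mul_left, ← h0.tsum_sub (h1.mul_left _)]
    refine tsum_congr fun k => ?_
    rw [hc k]
    ring
  have hs : Summable fun k : ℕ => 2 * (k : ℝ) * besselCoeff (ν + 1) k * s ^ k := by
    refine (h0.sub (h1.mul_left (2 * (ν + 1)))).congr fun k => ?_
    rw [hc k]
    ring
  rw [hs.tsum_eq_zero_add] at e
  have e2 : ∑' k : ℕ, 2 * ((k + 1 : ℕ) : ℝ) * besselCoeff (ν + 1) (k + 1) * s ^ (k + 1) =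
      -s * besselSeries (ν + 2) s := by
    unfold besselSeries
    rw [← tsum_mul_left]
    refine tsum_congr fun k => ?_
    have b := besselCoeff_succ_mul (show -1 < ν + 1 by linarith) k
    rw [show ν + 1 + 1 = ν + 2 by ring] at b
    push_cast
    rw [pow_succ]
    linear_combination (2 * s ^ k * s) * b
  rw [e2] at e
  simp at e
  linarith

lemma hasDerivAt_besselEntire {ν : ℝ} (hν : -1 < ν) (u : ℝ) :
    HasDerivAt (besselEntire ν) (-u * besselEntire (ν + 1) u) u := by
  have h := (hasDerivAt_besselSeries hν (u ^ 2)).comp u (hasDerivAt_pow 2 u)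
  refine h.congr_deriv ?_
  unfold besselEntire
  push_cast
  ring

lemma besselEntire_recurrence {ν : ℝ} (hν : -1 < ν) (u : ℝ) :
    besselEntire ν u =
      2 * (ν + 1) * besselEntire (ν + 1) u - u ^ 2 * besselEntire (ν + 2) u :=
  besselSeries_recurrence hν (u ^ 2)

lemma continuous_besselEntire {ν : ℝ} (hν : -1 < ν) : Continuous (besselEntire ν) :=
  continuous_iff_continuousAt.2 fun u => (hasDerivAt_besselEntire hν u).continuousAt

lemma besselQuot_eq_besselEntire (ν : ℝ) {u : ℝ} (hu : 0 < u) :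
    besselQuot ν u = besselEntire ν u := by
  have hp : u ^ ν ≠ 0 := (Real.rpow_pos_of_pos hu ν).ne'
  have h2 : (2 : ℝ) ^ ν ≠ 0 := by positivity
  unfold besselQuot besselEntire besselSeries besselJ
  rw [← tsum_div_const]
  refine tsum_congr fun k => ?_
  have e : (u / 2) ^ (2 * (k : ℝ) + ν) = (u ^ 2) ^ k * u ^ ν / (4 ^ k * (2 : ℝ) ^ ν) := by
    rw [Real.rpow_add (by positivity), Real.div_rpow hu.le zero_le_two ν,
      show (2 * (k : ℝ)) = ((2 * k : ℕ) : ℝ) by push_cast; ring, Real.rpow_natCast, pow_mul,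
      div_pow, div_pow]
    norm_num
    field_simp
  rw [e, besselCoeff]
  field_simp

/-! ### Asymptotics of Bessel functions at infinity -/

/-- A function with derivative `O(u⁻²)` on `[1, ∞)` converges at infinity with rate `O(u⁻¹)`. -/
lemma exists_limit_of_deriv_le {a a' : ℝ → ℝ} {D : ℝ}
    (ha : ∀ u, 1 ≤ u → HasDerivAt a (a' u) u) (hD : ∀ u, 1 ≤ u → |a' u| ≤ D / u ^ 2) :
    ∃ A, ∀ u, 1 ≤ u → |a u - A| ≤ D / u := by
  have hinv (u : ℝ) (hu : 1 ≤ u) : HasDerivAt (fun u => D / u) (-(D / u ^ 2)) u := by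
    have := (hasDerivAt_inv (show u ≠ 0 by positivity)).const_mul D
    refine this.congr_deriv ?_
    ring
  have hm : MonotoneOn (fun u => a u - D / u) (Ici 1) := by
    refine monotoneOn_of_hasDerivWithinAt_nonneg (convex_Ici 1)
      (f' := fun u => a' u - -(D / u ^ 2)) ?_ ?_ ?_
    · exact fun u hu => ((ha u hu).sub (hinv u hu)).continuousAt.continuousWithinAt
    · intro u hu
      have hu := interior_subset hu
      exact ((ha u hu).sub (hinv u hu)).hasDerivWithinAt
    · intro u hu
      have := abs_le.1 (hD u (interior_subset hu))
      linarith [this.1]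
  have hn : AntitoneOn (fun u => a u + D / u) (Ici 1) := by
    refine antitoneOn_of_hasDerivWithinAt_nonpos (convex_Ici 1)
      (f' := fun u => a' u + -(D / u ^ 2)) ?_ ?_ ?_
    · exact fun u hu => ((ha u hu).add (hinv u hu)).continuousAt.continuousWithinAt
    · intro u hu
      have hu := interior_subset hu
      exact ((ha u hu).add (hinv u hu)).hasDerivWithinAt
    · intro u hu
      have := abs_le.1 (hD u (interior_subset hu))
      linarith [this.2]
  have hD0 : 0 ≤ D := by
    have := (abs_nonneg _).trans (hD 1 le_rfl)
    simpa using this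
  have hub (u : ℝ) (hu : 1 ≤ u) :
      a u + D / u ∈ upperBounds ((fun v => a v - D / v) '' Ici 1) := by
    rintro _ ⟨v, hv, rfl⟩
    have hv : 1 ≤ v := hv
    have h1 : 0 ≤ D / u := by positivity
    have h2 : 0 ≤ D / v := by positivity
    rcases le_total u v with h | h
    · have := hn (show u ∈ Ici (1 : ℝ) from hu) hv h
      simp only at this ⊢
      linarith
    · have := hm hv (show u ∈ Ici (1 : ℝ) from hu) h
      simp only at this ⊢
      linarith
  refine ⟨sSup ((fun v => a v - D / v) '' Ici 1), fun u hu => ?_⟩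
  have h1 := le_csSup ⟨_, hub 1 le_rfl⟩ (mem_image_of_mem (fun v => a v - D / v) (mem_Ici.2 hu))
  have h2 := csSup_le ((nonempty_Ici (a := (1 : ℝ))).image _) (hub u hu)
  rw [abs_le]
  constructor <;> linarith

/-- Solutions of `w'' + w = c w / u²` are bounded on `[1, ∞)`: the energy `w² + w'²` satisfies
a Gronwall inequality with integrable coefficient `|c| / u²`. -/
lemma exists_bound_of_perturbed_oscillator {w w₁ : ℝ → ℝ} {c : ℝ}
    (hw : ∀ u, 1 ≤ u → HasDerivAt w (w₁ u) u)
    (hw₁ : ∀ u, 1 ≤ u → HasDerivAt w₁ (c / u ^ 2 * w u - w u) u) :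
    ∃ C, 0 ≤ C ∧ ∀ u, 1 ≤ u → |w u| ≤ C := by
  have hn : AntitoneOn (fun u => (w u ^ 2 + w₁ u ^ 2) * Real.exp (|c| / u)) (Ici 1) := by
    have hd (u : ℝ) (hu : 1 ≤ u) :
        HasDerivAt (fun u => (w u ^ 2 + w₁ u ^ 2) * Real.exp (|c| / u))
          ((2 * c * (w u * w₁ u) - |c| * (w u ^ 2 + w₁ u ^ 2)) / u ^ 2 *
            Real.exp (|c| / u)) u := by
      have hu0 : u ≠ 0 := by positivity
      have h1 := ((hw u hu).pow 2).add ((hw₁ u hu).pow 2)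
      have h2 := ((hasDerivAt_inv hu0).const_mul |c|).exp
      refine (h1.mul h2).congr_deriv ?_
      simp only [Pi.add_apply, Pi.pow_apply, div_eq_mul_inv]
      push_cast
      field_simp
      ring
    refine antitoneOn_of_hasDerivWithinAt_nonpos (convex_Ici 1)
      (fun u hu => (hd u hu).continuousAt.continuousWithinAt)
      (fun u hu => (hd u (interior_subset hu)).hasDerivWithinAt) ?_
    intro u hu
    refine mul_nonpos_of_nonpos_of_nonneg (div_nonpos_of_nonpos_of_nonneg ?_ (sq_nonneg u))
      (Real.exp_pos _).le
    have h1 : 2 * (w u * w₁ u) ≤ w u ^ 2 + w₁ u ^ 2 := by nlinarith [sq_nonneg (w u - w₁ u)]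
    have h2 : -(2 * (w u * w₁ u)) ≤ w u ^ 2 + w₁ u ^ 2 := by nlinarith [sq_nonneg (w u + w₁ u)]
    rcases abs_cases c with ⟨h, h'⟩ | ⟨h, h'⟩ <;> rw [h] <;> nlinarith
  refine ⟨√((w 1 ^ 2 + w₁ 1 ^ 2) * Real.exp (|c| / 1)), Real.sqrt_nonneg _, fun u hu => ?_⟩
  refine Real.abs_le_sqrt ?_
  have h := hn (mem_Ici.2 le_rfl) (mem_Ici.2 hu) hu
  simp only at h
  have h1 : 1 ≤ Real.exp (|c| / u) := Real.one_le_exp (by positivity)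
  nlinarith [sq_nonneg (w u), sq_nonneg (w₁ u)]

/-- Solutions of `w'' + w = c w / u²` are asymptotic to solutions of `w'' + w = 0`, by variation
of constants. -/
lemma exists_asymptotic_of_perturbed_oscillator {w w₁ : ℝ → ℝ} {c : ℝ}
    (hw : ∀ u, 1 ≤ u → HasDerivAt w (w₁ u) u)
    (hw₁ : ∀ u, 1 ≤ u → HasDerivAt w₁ (c / u ^ 2 * w u - w u) u) :
    ∃ A B C, ∀ u, 1 ≤ u → |w u - (A * Real.cos u + B * Real.sin u)| ≤ C / u := by
  obtain ⟨C, hC0, hC⟩ := exists_bound_of_perturbed_oscillator hw hw₁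
  have hg (u : ℝ) (hu : 1 ≤ u) : |c / u ^ 2 * w u| ≤ |c| * C / u ^ 2 := by
    rw [abs_mul, abs_div, abs_of_nonneg (sq_nonneg u), div_mul_eq_mul_div]
    gcongr
    exact hC u hu
  obtain ⟨A, hA⟩ := exists_limit_of_deriv_le (D := |c| * C)
    (a := fun u => w u * Real.cos u - w₁ u * Real.sin u)
    (a' := fun u => -(c / u ^ 2 * w u) * Real.sin u)
    (fun u hu => (((hw u hu).mul (Real.hasDerivAt_cos u)).sub
      ((hw₁ u hu).mul (Real.hasDerivAt_sin u))).congr_deriv (by ring))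
    (fun u hu => by
      rw [abs_mul, abs_neg]
      exact (mul_le_of_le_one_right (abs_nonneg _) (Real.abs_sin_le_one u)).trans (hg u hu))
  obtain ⟨B, hB⟩ := exists_limit_of_deriv_le (D := |c| * C)
    (a := fun u => w u * Real.sin u + w₁ u * Real.cos u)
    (a' := fun u => (c / u ^ 2 * w u) * Real.cos u)
    (fun u hu => (((hw u hu).mul (Real.hasDerivAt_sin u)).add
      ((hw₁ u hu).mul (Real.hasDerivAt_cos u))).congr_deriv (by ring))
    (fun u hu => by
      rw [abs_mul]
      exact (mul_le_of_le_one_right (abs_nonneg _) (Real.abs_cos_le_one u)).trans (hg u hu))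
  refine ⟨A, B, 2 * (|c| * C), fun u hu => ?_⟩
  have e : w u - (A * Real.cos u + B * Real.sin u) =
      (w u * Real.cos u - w₁ u * Real.sin u - A) * Real.cos u +
      (w u * Real.sin u + w₁ u * Real.cos u - B) * Real.sin u := by
    linear_combination (-(w u)) * Real.sin_sq_add_cos_sq u
  have h1 := mul_le_of_le_one_right
    (abs_nonneg (w u * Real.cos u - w₁ u * Real.sin u - A)) (Real.abs_cos_le_one u)
  have h2 := mul_le_of_le_one_right
    (abs_nonneg (w u * Real.sin u + w₁ u * Real.cos u - B)) (Real.abs_sin_le_one u)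
  rw [e]
  refine (abs_add_le _ _).trans ?_
  rw [abs_mul, abs_mul]
  have h3 := hA u hu
  have h4 := hB u hu
  have : 2 * (|c| * C) / u = |c| * C / u + |c| * C / u := by ring
  linarith

lemma exists_amplitude_phase (A B : ℝ) :
    ∃ R φ : ℝ, ∀ u, A * Real.cos u + B * Real.sin u = R * Real.cos (u + φ) := by
  refine ⟨‖(⟨A, -B⟩ : ℂ)‖, Complex.arg ⟨A, -B⟩, fun u => ?_⟩
  have h1 := Complex.norm_mul_cos_arg (⟨A, -B⟩ : ℂ)
  have h2 := Complex.norm_mul_sin_arg (⟨A, -B⟩ : ℂ)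
  simp only at h1 h2
  rw [Real.cos_add]
  linear_combination (-Real.cos u) * h1 + Real.sin u * h2

/-- `u^(1/2) J_ν(u)`, which solves the perturbed oscillator equation
`w'' + w = (ν² - 1/4) w / u²` on the half-line. -/
noncomputable def besselWave (ν u : ℝ) : ℝ := u ^ (ν + 1 / 2) * besselEntire ν u

lemma besselEntire_eq_besselWave (ν : ℝ) {u : ℝ} (hu : 0 < u) :
    besselEntire ν u = u ^ (-(ν + 1 / 2)) * besselWave ν u := by
  rw [besselWave, ← mul_assoc, ← Real.rpow_add hu, neg_add_cancel, Real.rpow_zero, one_mul]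

/-- The asymptotics `u^(1/2) J_ν(u) = R cos (u + φ) + O(u⁻¹)` as `u → ∞`. -/
lemma exists_besselWave_asymptotic {ν : ℝ} (hν : -1 < ν) :
    ∃ R φ C : ℝ, 0 ≤ C ∧ ∀ u, 1 ≤ u → |besselWave ν u - R * Real.cos (u + φ)| ≤ C / u := by
  set p := ν + 1 / 2 with hp
  have hpow (q u : ℝ) (hu : 1 ≤ u) : HasDerivAt (fun u : ℝ => u ^ q) (q * u ^ (q - 1)) u :=
    Real.hasDerivAt_rpow_const (Or.inl (by positivity))
  obtain ⟨A, B, C, h⟩ := exists_asymptotic_of_perturbed_oscillator (w := besselWave ν)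
    (w₁ := fun u => p * (u ^ (p - 1) * besselEntire ν u) - u ^ (p + 1) * besselEntire (ν + 1) u)
    (c := p * (p - 1))
    (fun u hu => by
      refine ((hpow p u hu).mul (hasDerivAt_besselEntire hν u)).congr_deriv ?_
      rw [Real.rpow_add_one (by positivity)]
      ring)
    (fun u hu => by
      have hu0 : u ≠ 0 := by positivity
      refine ((((hpow (p - 1) u hu).mul (hasDerivAt_besselEntire hν u)).const_mul p).sub
        ((hpow (p + 1) u hu).mul
          (hasDerivAt_besselEntire (show -1 < ν + 1 by linarith) u))).congr_deriv ?_
      have hr := besselEntire_recurrence hν u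
      have e : besselEntire (ν + 1 + 1) u = besselEntire (ν + 2) u := by
        rw [show ν + 1 + 1 = ν + 2 by ring]
      rw [besselWave, ← hp, e, show p + 1 - 1 = p by ring, Real.rpow_add_one hu0,
        Real.rpow_sub_one hu0, Real.rpow_sub_one hu0]
      have hpν : 2 * ν = 2 * p - 1 := by rw [hp]; ring
      field_simp
      linear_combination (u ^ 2) * hr - (u ^ 2 * besselEntire (ν + 1) u) * hpν)
  obtain ⟨R, φ, hR⟩ := exists_amplitude_phase A B
  refine ⟨R, φ, C, ?_, fun u hu => ?_⟩
  · simpa using (abs_nonneg _).trans (h 1 le_rfl)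
  · rw [← hR]
    exact h u hu

lemma exists_besselWave_bound {ν : ℝ} (hν : -1 < ν) :
    ∃ C : ℝ, 0 ≤ C ∧ ∀ u, 1 ≤ u → |besselWave ν u| ≤ C := by
  obtain ⟨R, φ, C, hC, h⟩ := exists_besselWave_asymptotic hν
  refine ⟨|R| + C, by positivity, fun u hu => ?_⟩
  have h1 := h u hu
  have h2 : |R * Real.cos (u + φ)| ≤ |R| := by
    rw [abs_mul]
    exact mul_le_of_le_one_right (abs_nonneg _) (Real.abs_cos_le_one _)
  have h3 : C / u ≤ C := div_le_self hC hu
  have h4 := abs_sub_abs_le_abs_sub (besselWave ν u) (R * Real.cos (u + φ))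
  linarith

/-- The decay `J_ν(u) / u^ν = O(u^(-ν-1/2))`. -/
lemma exists_besselEntire_bound {ν : ℝ} (hν : -1 < ν) :
    ∃ C : ℝ, 0 ≤ C ∧ ∀ u, 1 ≤ u → |besselEntire ν u| ≤ C * u ^ (-(ν + 1 / 2)) := by
  obtain ⟨C, hC, h⟩ := exists_besselWave_bound hν
  refine ⟨C, hC, fun u hu => ?_⟩
  have hu0 : 0 < u := by positivity
  rw [besselEntire_eq_besselWave ν hu0, abs_mul, abs_of_pos (Real.rpow_pos_of_pos hu0 _),
    mul_comm]
  gcongr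
  exact h u hu

/-! ### Oscillatory integrals -/

/-- Interpolation between the bounds `2` and `|λ| y` for the difference of sines. -/
lemma abs_sin_sub_sin_le_rpow {l y φ θ : ℝ} (hy : 0 ≤ y) (hθ : 0 ≤ θ) (hθ1 : θ ≤ 1) :
    |Real.sin (l * y + φ) - Real.sin φ| ≤ 2 * (|l| ^ θ * y ^ θ) := by
  rw [← Real.mul_rpow (abs_nonneg l) hy]
  have h1 : |Real.sin (l * y + φ) - Real.sin φ| ≤ |l| * y := by
    refine (Real.abs_sin_sub_sin_le _ _).trans_eq ?_
    rw [add_sub_cancel_right, abs_mul, abs_of_nonneg hy]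
  have h2 : |Real.sin (l * y + φ) - Real.sin φ| ≤ 2 := by
    have a := Real.abs_sin_le_one (l * y + φ)
    have b := Real.abs_sin_le_one φ
    have c := abs_sub (Real.sin (l * y + φ)) (Real.sin φ)
    linarith
  have h0 : 0 ≤ |l| * y := by positivity
  have hp : 0 ≤ (|l| * y) ^ θ := by positivity
  rcases le_total (|l| * y) 1 with h | h
  · have := Real.rpow_le_rpow_of_exponent_ge' h0 h hθ hθ1
    rw [Real.rpow_one] at this
    linarith
  · have := Real.one_le_rpow h hθ
    linarith

/-- The integrals `∫_Y^∞ y^(-δ) cos (λ y + φ) dy` converge for `λ ≠ 0`, and the truncated integrals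
are bounded by a multiple of `|λ|^(θ-1)`, uniformly in the truncation, the frequency and the phase.
The proof is an integration by parts with the primitive `(sin (λ y + φ) - sin φ) / λ` of the
cosine, which is `O(|λ|^(θ-1) y^θ)`. -/
lemma exists_oscillatory_bound {δ θ Y : ℝ} (hθ : 0 < θ) (hθ1 : θ ≤ 1) (hδ : θ < δ) (hY : 0 < Y) :
    ∃ C : ℝ, 0 ≤ C ∧ ∀ l φ : ℝ, l ≠ 0 →
      (∃ L, Tendsto (fun N => ∫ y in Y..N, y ^ (-δ) * Real.cos (l * y + φ)) atTop (𝓝 L)) ∧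
      ∀ N, Y ≤ N → |∫ y in Y..N, y ^ (-δ) * Real.cos (l * y + φ)| ≤ C * |l| ^ (θ - 1) := by
  have hint : IntegrableOn (fun y : ℝ => y ^ (θ - δ - 1)) (Ioi Y) :=
    integrableOn_Ioi_rpow_of_lt (by linarith) hY
  have hI0 : 0 ≤ ∫ y in Ioi Y, y ^ (θ - δ - 1) :=
    setIntegral_nonneg measurableSet_Ioi fun y hy => Real.rpow_nonneg (hY.trans hy).le _
  have hδ0 : 0 < δ := hθ.trans hδ
  refine ⟨2 * Y ^ (θ - δ) + 2 * Y ^ (θ - δ) + 2 * δ * ∫ y in Ioi Y, y ^ (θ - δ - 1),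
    by positivity, fun l φ hl => ?_⟩
  set S : ℝ → ℝ := fun y => Real.sin (l * y + φ) - Real.sin φ with hS
  set G : ℝ → ℝ := fun y => y ^ (-δ) * S y / l with hG
  set H : ℝ → ℝ := fun y => δ * (y ^ (-δ - 1) * S y / l) with hH
  have habs : 0 < |l| := abs_pos.2 hl
  have hpow (q y : ℝ) (hy : 0 < y) : |y ^ q * S y / l| ≤ 2 * |l| ^ (θ - 1) * y ^ (θ + q) := by
    rw [abs_div, abs_mul, abs_of_pos (Real.rpow_pos_of_pos hy q), div_le_iff₀ habs,
      Real.rpow_sub_one habs.ne', Real.rpow_add hy]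
    have h := abs_sin_sub_sin_le_rpow (l := l) (φ := φ) hy.le hθ.le hθ1
    have hq := Real.rpow_pos_of_pos hy q
    calc y ^ q * |S y| ≤ y ^ q * (2 * (|l| ^ θ * y ^ θ)) := by gcongr
      _ = _ := by field_simp
  have hGb (y : ℝ) (hy : 0 < y) : |G y| ≤ 2 * |l| ^ (θ - 1) * y ^ (θ - δ) := hpow (-δ) y hy
  have hHb (y : ℝ) (hy : 0 < y) : |H y| ≤ |l| ^ (θ - 1) * (2 * δ * y ^ (θ - δ - 1)) := by
    have h := hpow (-δ - 1) y hy
    rw [show θ + (-δ - 1) = θ - δ - 1 by ring] at h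
    rw [hH, abs_mul, abs_of_pos (hθ.trans hδ)]
    nlinarith [hθ.trans hδ]
  have hScont : Continuous S := by fun_prop
  have hrpow (q : ℝ) : ContinuousOn (fun y : ℝ => y ^ q) (Ioi 0) := fun y hy =>
    (Real.continuousAt_rpow_const y q (Or.inl (ne_of_gt hy))).continuousWithinAt
  have hHcont : ContinuousOn H (Ioi 0) :=
    (((hrpow _).mul hScont.continuousOn).div_const l).const_mul δ |>.congr fun y _ => rfl
  have hCcont : ContinuousOn (fun y : ℝ => y ^ (-δ) * Real.cos (l * y + φ)) (Ioi 0) :=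
    (hrpow _).mul (by fun_prop)
  have hsub (N : ℝ) (hN : Y ≤ N) : uIcc Y N ⊆ Ioi 0 := by
    rw [uIcc_of_le hN]
    exact fun y hy => hY.trans_le hy.1
  have hHint : IntegrableOn H (Ioi Y) := by
    refine Integrable.mono' (g := fun y => |l| ^ (θ - 1) * (2 * δ * y ^ (θ - δ - 1)))
      ((hint.const_mul _).const_mul _) ?_ ?_
    · exact (hHcont.mono (Ioi_subset_Ioi hY.le)).aestronglyMeasurable measurableSet_Ioi
    · exact (ae_restrict_mem measurableSet_Ioi).mono fun y hy => hHb y (hY.trans hy)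
  have hparts (N : ℝ) (hN : Y ≤ N) : ∫ y in Y..N, y ^ (-δ) * Real.cos (l * y + φ) =
      G N - G Y + ∫ y in Y..N, H y := by
    have hd (y : ℝ) (hy : y ∈ uIcc Y N) :
        HasDerivAt G (y ^ (-δ) * Real.cos (l * y + φ) - H y) y := by
      have hy0 : 0 < y := hsub N hN hy
      have h1 : HasDerivAt S (Real.cos (l * y + φ) * l) y := by
        refine ((((hasDerivAt_id y).const_mul l).add_const φ).sin.sub_const
          (Real.sin φ)).congr_deriv ?_
        simp
      have h2 := ((Real.hasDerivAt_rpow_const (p := -δ) (Or.inl hy0.ne')).mul h1).div_const l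
      refine h2.congr_deriv ?_
      rw [hH]
      field_simp
      ring
    have hi1 : IntervalIntegrable (fun y : ℝ => y ^ (-δ) * Real.cos (l * y + φ)) volume Y N :=
      (hCcont.mono (hsub N hN)).intervalIntegrable
    have hi2 : IntervalIntegrable H volume Y N := (hHcont.mono (hsub N hN)).intervalIntegrable
    rw [← intervalIntegral.integral_eq_sub_of_hasDerivAt hd (hi1.sub hi2),
      intervalIntegral.integral_sub hi1 hi2]
    ring
  constructor
  · refine ⟨0 - G Y + ∫ y in Ioi Y, H y, ?_⟩
    have hG0 : Tendsto G atTop (𝓝 0) := by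
      refine squeeze_zero_norm' (a := fun y => 2 * |l| ^ (θ - 1) * y ^ (-(δ - θ))) ?_ ?_
      · filter_upwards [eventually_gt_atTop 0] with y hy
        rw [neg_sub]
        exact hGb y hy
      · simpa using (tendsto_rpow_neg_atTop (sub_pos.2 hδ)).const_mul (2 * |l| ^ (θ - 1))
    refine ((hG0.sub_const _).add
      (intervalIntegral_tendsto_integral_Ioi Y hHint tendsto_id)).congr' ?_
    filter_upwards [eventually_ge_atTop Y] with N hN
    rw [hparts N hN, id]
  · intro N hN
    rw [hparts N hN]
    have h1 : |∫ y in Y..N, H y| ≤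
        |l| ^ (θ - 1) * (2 * δ * ∫ y in Ioi Y, y ^ (θ - δ - 1)) := by
      rw [intervalIntegral.integral_of_le hN, ← integral_const_mul, ← integral_const_mul,
        ← Real.norm_eq_abs]
      refine (norm_integral_le_integral_norm _).trans ?_
      refine (setIntegral_mono_set hHint.norm (ae_of_all _ fun y => norm_nonneg _)
        Ioc_subset_Ioi_self.eventuallyLE).trans ?_
      exact setIntegral_mono_on hHint.norm ((hint.const_mul _).const_mul _) measurableSet_Ioi
        fun y hy => hHb y (hY.trans hy)
    have h2 := hGb Y hY
    have h3 := hGb N (hY.trans_le hN)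
    have h4 : N ^ (θ - δ) ≤ Y ^ (θ - δ) := by
      exact Real.rpow_le_rpow_of_nonpos hY hN (by linarith)
    have h5 : 0 < |l| ^ (θ - 1) := Real.rpow_pos_of_pos habs _
    have h6 := abs_add_le (G N - G Y) (∫ y in Y..N, H y)
    have h7 := abs_sub (G N) (G Y)
    have h8 : 2 * |l| ^ (θ - 1) * N ^ (θ - δ) ≤ 2 * |l| ^ (θ - 1) * Y ^ (θ - δ) := by gcongr
    linarith

/-! ### The measure `μ_α` -/

lemma mu_restrict {s : Set ℝ} (hs : MeasurableSet s) (hs0 : s ⊆ Ioi 0) (α : ℝ) :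
    (mu α).restrict s =
      (volume.restrict s).withDensity fun y => ENNReal.ofReal (y ^ (2 * α + 1)) := by
  rw [mu, restrict_withDensity hs, Measure.restrict_restrict_of_subset hs0]

lemma mu_restrict_Ioi (α : ℝ) : (mu α).restrict (Ioi 0) = mu α := by
  rw [mu_restrict measurableSet_Ioi subset_rfl, mu]

lemma ae_mu_pos (α : ℝ) : ∀ᵐ y ∂(mu α), 0 < y := by
  rw [← mu_restrict_Ioi]
  exact ae_restrict_mem measurableSet_Ioi

lemma setIntegral_mu {E : Type*} [NormedAddCommGroup E] [NormedSpace ℝ E] {s : Set ℝ}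
    (hs : MeasurableSet s) (hs0 : s ⊆ Ioi 0) (α : ℝ) (g : ℝ → E) :
    ∫ y in s, g y ∂(mu α) = ∫ y in s, y ^ (2 * α + 1) • g y := by
  rw [mu_restrict hs hs0, integral_withDensity_eq_integral_toReal_smul (by fun_prop) (by simp)]
  refine setIntegral_congr_fun hs fun y hy => ?_
  rw [ENNReal.toReal_ofReal (Real.rpow_nonneg (le_of_lt (hs0 hy)) _)]

lemma integral_mu {E : Type*} [NormedAddCommGroup E] [NormedSpace ℝ E] (α : ℝ) (g : ℝ → E) :
    ∫ y, g y ∂(mu α) = ∫ y in Ioi 0, y ^ (2 * α + 1) • g y := by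
  rw [← setIntegral_mu measurableSet_Ioi subset_rfl, mu_restrict_Ioi]

lemma integrableOn_mu_iff {E : Type*} [NormedAddCommGroup E] [NormedSpace ℝ E] {s : Set ℝ}
    (hs : MeasurableSet s) (hs0 : s ⊆ Ioi 0) (α : ℝ) (g : ℝ → E) :
    IntegrableOn g s (mu α) ↔ IntegrableOn (fun y => y ^ (2 * α + 1) • g y) s := by
  rw [IntegrableOn, mu_restrict hs hs0,
    integrable_withDensity_iff_integrable_smul' (by fun_prop) (by simp), ← IntegrableOn]
  refine integrableOn_congr_fun (fun y hy => ?_) hs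
  rw [ENNReal.toReal_ofReal (Real.rpow_nonneg (le_of_lt (hs0 hy)) _)]

lemma integrable_mu_iff {E : Type*} [NormedAddCommGroup E] [NormedSpace ℝ E] (α : ℝ)
    (g : ℝ → E) :
    Integrable g (mu α) ↔ IntegrableOn (fun y => y ^ (2 * α + 1) • g y) (Ioi 0) := by
  rw [← integrableOn_mu_iff measurableSet_Ioi subset_rfl, IntegrableOn, mu_restrict_Ioi]

instance sFinite_mu (α : ℝ) : SFinite (mu α) := by
  unfold mu
  infer_instance

lemma isFiniteMeasureOnCompacts_mu {α : ℝ} (hα : -1 < α) :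
    IsFiniteMeasureOnCompacts (mu α) := by
  refine ⟨fun K hK => ?_⟩
  obtain ⟨R, hR⟩ := hK.isBounded.exists_pos_norm_le
  have hint : IntegrableOn (fun _ : ℝ => (1 : ℝ)) (Ioc 0 R) (mu α) := by
    rw [integrableOn_mu_iff measurableSet_Ioc Ioc_subset_Ioi_self]
    simp only [smul_eq_mul, mul_one]
    rw [← intervalIntegrable_iff_integrableOn_Ioc_of_le hR.1.le]
    exact intervalIntegral.intervalIntegrable_rpow' (by linarith)
  rw [integrableOn_const_iff] at hint
  have hfin : mu α (Ioc 0 R) < ⊤ := by simpa using hint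
  rw [← mu_restrict_Ioi, Measure.restrict_apply hK.measurableSet]
  refine (measure_mono ?_).trans_lt hfin
  exact fun y hy => ⟨hy.2, (le_abs_self y).trans (hR.2 y hy.1)⟩

/-! ### Functions compactly supported in the half-line -/

section CompactSupport

variable {E : Type*} [NormedAddCommGroup E] {f : ℝ → E}

lemma exists_tsupport_subset_Icc (hf : HasCompactSupport f) (hf0 : tsupport f ⊆ Ioi 0) :
    ∃ a b : ℝ, 0 < a ∧ tsupport f ⊆ Icc a b := by
  rcases (tsupport f).eq_empty_or_nonempty with h | h
  · exact ⟨1, 1, one_pos, by simp [h]⟩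
  · obtain ⟨a, ha⟩ := hf.isCompact.exists_isLeast h
    obtain ⟨b, hb⟩ := hf.isCompact.exists_isGreatest h
    exact ⟨a, b, hf0 ha.1, fun z hz => ⟨ha.2 hz, hb.2 hz⟩⟩

lemma eq_zero_of_notMem_Ioi (hf0 : tsupport f ⊆ Ioi 0) {z : ℝ} (hz : z ∉ Ioi (0 : ℝ)) :
    f z = 0 :=
  image_eq_zero_of_notMem_tsupport fun h => hz (hf0 h)

variable [NormedSpace ℝ E]

lemma continuous_rpow_smul (hf : Continuous f) (hf0 : tsupport f ⊆ Ioi 0) (q : ℝ) :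
    Continuous fun z : ℝ => z ^ q • f z := by
  refine continuous_iff_continuousAt.2 fun z => ?_
  by_cases hz : z ∈ tsupport f
  · exact (Real.continuousAt_rpow_const z q (Or.inl (ne_of_gt (hf0 hz)))).smul hf.continuousAt
  · refine (continuousAt_const (y := (0 : E))).congr ?_
    filter_upwards [notMem_tsupport_iff_eventuallyEq.1 hz] with y hy
    simp [hy]

lemma hasCompactSupport_rpow_smul (hf : HasCompactSupport f) (q : ℝ) :
    HasCompactSupport fun z : ℝ => z ^ q • f z :=
  hf.smul_left (f := fun z : ℝ => z ^ q)

/-- For `f` supported in the half-line, integration of `g f` against `μ_α` is integration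
of `g(z) z^(2α+1) f(z)` over the whole line. -/
lemma integral_smul_mu (hf0 : tsupport f ⊆ Ioi 0) (α : ℝ) (g : ℝ → ℝ) :
    ∫ z, g z • f z ∂(mu α) = ∫ z, g z • (z ^ (2 * α + 1) • f z) := by
  rw [integral_mu, setIntegral_eq_integral_of_forall_compl_eq_zero]
  · exact integral_congr_ae (ae_of_all _ fun z => smul_comm _ _ _)
  · intro z hz
    rw [eq_zero_of_notMem_Ioi hf0 hz, smul_zero, smul_zero]

lemma integrable_smul_mu (hf : Continuous f) (hfc : HasCompactSupport f)
    (hf0 : tsupport f ⊆ Ioi 0) (α : ℝ) {g : ℝ → ℝ} (hg : LocallyIntegrable g) :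
    Integrable (fun z => g z • f z) (mu α) := by
  rw [integrable_mu_iff]
  have := hg.integrable_smul_right_of_hasCompactSupport (continuous_rpow_smul hf hf0 (2 * α + 1))
    (hasCompactSupport_rpow_smul hfc _)
  exact (this.congr (ae_of_all _ fun z => smul_comm _ _ _)).integrableOn

end CompactSupport

lemma locallyIntegrable_abs_rpow {r : ℝ} (hr : -1 < r) :
    LocallyIntegrable fun z : ℝ => |z| ^ r := by
  refine locallyIntegrable_of_norm_le_rpow (C := 1) (α := -r) (by simp) (by simp; linarith)
    (ae_of_all _ fun z => ?_) (Measurable.pow_const (by fun_prop) r).aestronglyMeasurable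
  rw [neg_neg, one_mul, Real.norm_of_nonneg (by positivity), Real.norm_eq_abs]

lemma locallyIntegrable_abs_add_rpow {r : ℝ} (hr : -1 < r) (c : ℝ) :
    LocallyIntegrable fun z : ℝ => |c + z| ^ r := by
  have h := locallyIntegrable_abs_rpow hr
  rw [← map_add_left_eq_self volume c] at h
  exact (locallyIntegrable_map_homeomorph (Homeomorph.addLeft c)).1 h

lemma locallyIntegrable_abs_sub_rpow {r : ℝ} (hr : -1 < r) (c : ℝ) :
    LocallyIntegrable fun z : ℝ => |c - z| ^ r := by
  have h := locallyIntegrable_abs_rpow hr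
  rw [← (Measure.measurePreserving_sub_left volume c).map_eq] at h
  exact (locallyIntegrable_map_homeomorph (Homeomorph.subLeft c)).1 h

/-! ### Truncated integrals of the triple product -/

/-- The function `g` is continuous on the half-line, and its integrals over `[Y, N]` converge
as `N → ∞` and are bounded by `M`. -/
structure HasTailBound (Y : ℝ) (g : ℝ → ℝ) (M : ℝ) : Prop where
  continuousOn : ContinuousOn g (Ioi 0)
  exists_tendsto : ∃ L, Tendsto (fun N => ∫ y in Y..N, g y) atTop (𝓝 L)
  bound : ∀ N, Y ≤ N → |∫ y in Y..N, g y| ≤ M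

namespace HasTailBound

variable {Y M M' : ℝ} {g g' : ℝ → ℝ}

lemma intervalIntegrable (hY : 0 < Y) (hg : ContinuousOn g (Ioi 0)) {N : ℝ} (hN : Y ≤ N) :
    IntervalIntegrable g volume Y N := by
  refine (hg.mono ?_).intervalIntegrable
  rw [uIcc_of_le hN]
  exact fun y hy => hY.trans_le hy.1

lemma add (hY : 0 < Y) (h : HasTailBound Y g M) (h' : HasTailBound Y g' M') :
    HasTailBound Y (fun y => g y + g' y) (M + M') := by
  have e (N : ℝ) (hN : Y ≤ N) := intervalIntegral.integral_add
    (intervalIntegrable hY h.continuousOn hN) (intervalIntegrable hY h'.continuousOn hN)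
  refine ⟨h.continuousOn.add h'.continuousOn, ?_, fun N hN => ?_⟩
  · obtain ⟨L, hL⟩ := h.exists_tendsto
    obtain ⟨L', hL'⟩ := h'.exists_tendsto
    refine ⟨L + L', (hL.add hL').congr' ?_⟩
    filter_upwards [eventually_ge_atTop Y] with N hN
    exact (e N hN).symm
  · rw [e N hN]
    exact (abs_add_le _ _).trans (add_le_add (h.bound N hN) (h'.bound N hN))

lemma const_mul (c : ℝ) (h : HasTailBound Y g M) :
    HasTailBound Y (fun y => c * g y) (|c| * M) := by
  refine ⟨h.continuousOn.const_mul c, ?_, fun N hN => ?_⟩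
  · obtain ⟨L, hL⟩ := h.exists_tendsto
    exact ⟨c * L, by simpa only [intervalIntegral.integral_const_mul] using hL.const_mul c⟩
  · rw [intervalIntegral.integral_const_mul, abs_mul]
    exact mul_le_mul_of_nonneg_left (h.bound N hN) (abs_nonneg c)

lemma congr (hY : 0 < Y) (h : HasTailBound Y g M) (he : EqOn g' g (Ioi 0)) :
    HasTailBound Y g' M := by
  have e (N : ℝ) (hN : Y ≤ N) : ∫ y in Y..N, g' y = ∫ y in Y..N, g y := by
    refine intervalIntegral.integral_congr fun y hy => he ?_
    rw [uIcc_of_le hN] at hy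
    exact hY.trans_le hy.1
  refine ⟨h.continuousOn.congr he, ?_, fun N hN => (e N hN).symm ▸ h.bound N hN⟩
  obtain ⟨L, hL⟩ := h.exists_tendsto
  refine ⟨L, hL.congr' ?_⟩
  filter_upwards [eventually_ge_atTop Y] with N hN
  exact (e N hN).symm

lemma mono (h : HasTailBound Y g M) (hM : M ≤ M') : HasTailBound Y g M' :=
  ⟨h.continuousOn, h.exists_tendsto, fun N hN => (h.bound N hN).trans hM⟩

lemma of_abs_le (hY : 0 < Y) (hg : ContinuousOn g (Ioi 0)) {G : ℝ → ℝ}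
    (hG : IntegrableOn G (Ioi Y)) (hgG : ∀ y, Y < y → |g y| ≤ G y) :
    HasTailBound Y g (∫ y in Ioi Y, G y) := by
  have hgi : IntegrableOn g (Ioi Y) :=
    hG.mono' ((hg.mono (Ioi_subset_Ioi hY.le)).aestronglyMeasurable measurableSet_Ioi)
      ((ae_restrict_mem measurableSet_Ioi).mono hgG)
  refine ⟨hg, ⟨_, intervalIntegral_tendsto_integral_Ioi Y hgi tendsto_id⟩, fun N hN => ?_⟩
  rw [intervalIntegral.integral_of_le hN, ← Real.norm_eq_abs]
  refine (norm_integral_le_integral_norm _).trans ?_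
  refine (setIntegral_mono_set hgi.norm (ae_of_all _ fun y => norm_nonneg _)
    Ioc_subset_Ioi_self.eventuallyLE).trans ?_
  exact setIntegral_mono_on hgi.norm hG measurableSet_Ioi hgG

end HasTailBound

lemma cos_mul_cos_mul_cos (a b c : ℝ) :
    Real.cos a * Real.cos b * Real.cos c =
      1 / 4 * (Real.cos (a + b + c) + Real.cos (a + b - c) + Real.cos (a - b + c) +
        Real.cos (a - b - c)) := by
  simp only [Real.cos_add, Real.cos_sub, Real.sin_add, Real.sin_sub]
  ring

/-- The four frequencies `t ± x ± z` of the leading part of the triple Bessel product enter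
the bound of the kernel through the locally integrable function `∑ |t ± x ± z|^r` of `z`. -/
noncomputable def resonanceWeight (r t x z : ℝ) : ℝ :=
  |t + x + z| ^ r + |t + x - z| ^ r + |t - x + z| ^ r + |t - x - z| ^ r

lemma locallyIntegrable_resonanceWeight {r : ℝ} (hr : -1 < r) (t x : ℝ) :
    LocallyIntegrable (resonanceWeight r t x) :=
  (((locallyIntegrable_abs_add_rpow hr (t + x)).add
    (locallyIntegrable_abs_sub_rpow hr (t + x))).add
    (locallyIntegrable_abs_add_rpow hr (t - x))).add
    (locallyIntegrable_abs_sub_rpow hr (t - x))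

/-- None of the frequencies `t ± x ± z` vanishes. -/
def NonResonant (t x z : ℝ) : Prop :=
  t + x + z ≠ 0 ∧ t + x - z ≠ 0 ∧ t - x + z ≠ 0 ∧ t - x - z ≠ 0

lemma ae_nonResonant (t x : ℝ) : ∀ᵐ z : ℝ, NonResonant t x z := by
  have h (c : ℝ) : ∀ᵐ z : ℝ, z ≠ c := by simp [ae_iff]
  filter_upwards [h (-(t + x)), h (t + x), h (-(t - x)), h (t - x)] with z h1 h2 h3 h4
  exact ⟨fun h => h1 (by linarith), fun h => h2 (by linarith), fun h => h3 (by linarith),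
    fun h => h4 (by linarith)⟩

lemma abs_mul_mul_sub_le {w₁ w₂ w₃ p₁ p₂ p₃ B₁ B₂ B₃ ε₁ ε₂ ε₃ : ℝ}
    (h₂ : |w₂| ≤ B₂) (h₃ : |w₃| ≤ B₃) (k₁ : |p₁| ≤ B₁) (k₂ : |p₂| ≤ B₂)
    (e₁ : |w₁ - p₁| ≤ ε₁) (e₂ : |w₂ - p₂| ≤ ε₂) (e₃ : |w₃ - p₃| ≤ ε₃) :
    |w₁ * w₂ * w₃ - p₁ * p₂ * p₃| ≤ ε₁ * B₂ * B₃ + B₁ * ε₂ * B₃ + B₁ * B₂ * ε₃ := by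
  have e : w₁ * w₂ * w₃ - p₁ * p₂ * p₃ =
      (w₁ - p₁) * w₂ * w₃ + p₁ * (w₂ - p₂) * w₃ + p₁ * p₂ * (w₃ - p₃) := by ring
  have hε₁ := (abs_nonneg _).trans e₁
  have hε₂ := (abs_nonneg _).trans e₂
  have hB₁ := (abs_nonneg _).trans k₁
  have hB₂ := (abs_nonneg _).trans k₂
  rw [e]
  refine (abs_add_three _ _ _).trans ?_
  simp only [abs_mul]
  gcongr

lemma continuousOn_besselWave {ν : ℝ} (hν : -1 < ν) : ContinuousOn (besselWave ν) (Ioi 0) :=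
  fun u hu => ((Real.continuousAt_rpow_const u _ (Or.inl (ne_of_gt hu))).mul
    (continuous_besselEntire hν).continuousAt).continuousWithinAt

/-- The product of the three Bessel functions of the kernel, continued to all real arguments. -/
noncomputable def tripleEntire (α β t x z y : ℝ) : ℝ :=
  besselEntire (α + β) (t * y) * besselEntire α (x * y) * besselEntire α (z * y)

lemma tripleBessel_eq_tripleEntire {α β t x z y : ℝ} (ht : 0 < t) (hx : 0 < x) (hz : 0 < z)
    (hy : 0 < y) : tripleBessel α β t x z y = tripleEntire α β t x z y := by
  rw [tripleBessel, tripleEntire, besselQuot_eq_besselEntire _ (mul_pos ht hy),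
    besselQuot_eq_besselEntire _ (mul_pos hx hy), besselQuot_eq_besselEntire _ (mul_pos hz hy)]

lemma continuous_tripleEntire {α β : ℝ} (hα : -1 < α) (hαβ : -1 < α + β) (t x : ℝ) :
    Continuous fun p : ℝ × ℝ => tripleEntire α β t x p.1 p.2 := by
  have h1 := continuous_besselEntire hα
  have h2 := continuous_besselEntire hαβ
  unfold tripleEntire
  fun_prop

lemma weight_mul_tripleEntire {α β t x z y : ℝ} (ht : 0 < t) (hx : 0 < x) (hz : 0 < z)
    (hy : 0 < y) : y ^ (2 * α + 1) * tripleEntire α β t x z y =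
      t ^ (-(α + β + 1 / 2)) * x ^ (-(α + 1 / 2)) * z ^ (-(α + 1 / 2)) *
        (y ^ (-(α + β + 1 / 2)) *
          (besselWave (α + β) (t * y) * besselWave α (x * y) * besselWave α (z * y))) := by
  rw [tripleEntire, besselEntire_eq_besselWave _ (mul_pos ht hy),
    besselEntire_eq_besselWave _ (mul_pos hx hy), besselEntire_eq_besselWave _ (mul_pos hz hy),
    Real.mul_rpow ht.le hy.le, Real.mul_rpow hx.le hy.le, Real.mul_rpow hz.le hy.le]
  have e : y ^ (2 * α + 1) * (y ^ (-(α + 1 / 2)) * y ^ (-(α + 1 / 2))) = 1 := by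
    rw [← Real.rpow_add hy, ← Real.rpow_add hy, ← Real.rpow_zero y]
    congr 1
    ring
  linear_combination (t ^ (-(α + β + 1 / 2)) * x ^ (-(α + 1 / 2)) * z ^ (-(α + 1 / 2)) *
        (y ^ (-(α + β + 1 / 2)) *
          (besselWave (α + β) (t * y) * besselWave α (x * y) * besselWave α (z * y)))) * e

/-- Off the resonances the integral of the triple product converges at infinity, and its truncations
are dominated, locally uniformly in `z`, by a locally integrable function of `z`. -/
lemma exists_hasTailBound_tripleEntire {α β t x a b : ℝ} (hα : -1 < α)
    (hαβ : -(1 / 2 : ℝ) < α + β) (ht : 0 < t) (hx : 0 < x) (ha : 0 < a) :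
    ∃ Y r C : ℝ, 0 < Y ∧ -1 < r ∧ 0 ≤ C ∧ ∀ z ∈ Icc a b, NonResonant t x z →
      HasTailBound Y (fun y => y ^ (2 * α + 1) * tripleEntire α β t x z y)
        (C * (1 + resonanceWeight r t x z)) := by
  set δ := α + β + 1 / 2 with hδ
  have hδ0 : 0 < δ := by linarith
  have hαβ' : -1 < α + β := by linarith
  obtain ⟨R₁, φ₁, C₁, hC₁, h₁⟩ := exists_besselWave_asymptotic hαβ'
  obtain ⟨R₂, φ₂, C₂, hC₂, h₂⟩ := exists_besselWave_asymptotic hα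
  obtain ⟨B, hB0, hB⟩ := exists_besselWave_bound hα
  -- `1 ≤ t y, x y, z y` for `y ≥ Y` and `z ≥ a`, so that the asymptotics apply
  set Y := max (1 / t) (max (1 / x) (1 / a)) with hYdef
  have hY : 0 < Y := lt_max_of_lt_left (by positivity)
  have hge (s y : ℝ) (hs : 0 < s) (hsY : 1 / s ≤ Y) (hy : Y < y) : 1 ≤ s * y := by
    have := (div_le_iff₀ hs).1 (hsY.trans hy.le)
    linarith
  have htY : 1 / t ≤ Y := le_max_left _ _
  have hxY : 1 / x ≤ Y := (le_max_left _ _).trans (le_max_right _ _)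
  have haY : 1 / a ≤ Y := (le_max_right _ _).trans (le_max_right _ _)
  set θ := min δ 1 / 2 with hθ
  have hθ0 : 0 < θ := by
    have : 0 < min δ 1 := lt_min hδ0 one_pos
    positivity
  have hθ1 : θ ≤ 1 := by
    have : min δ 1 ≤ 1 := min_le_right _ _
    linarith
  have hθδ : θ < δ := by
    have : min δ 1 ≤ δ := min_le_left _ _
    linarith
  obtain ⟨D, hD0, hD⟩ := exists_oscillatory_bound hθ0 hθ1 hθδ hY
  obtain ⟨Z, hZ⟩ := isCompact_Icc.exists_bound_of_continuousOn (s := Icc a b)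
    (f := fun z : ℝ => z ^ (-(α + 1 / 2))) fun z hz =>
      (Real.continuousAt_rpow_const z _
        (Or.inl (ne_of_gt (ha.trans_le hz.1)))).continuousWithinAt
  set P := |R₂| + B with hP
  have hP0 : 0 ≤ P := by positivity
  set κ := t ^ (-δ) * x ^ (-(α + 1 / 2)) with hκ
  set E := C₁ / t * P * P + |R₁| * (C₂ / x) * P + |R₁| * P * (C₂ / a) with hE
  have hE0 : 0 ≤ E := by positivity
  set Q := |R₁ * R₂ * R₂ * (1 / 4)| with hQ
  have hGint : IntegrableOn (fun y : ℝ => E * y ^ (-δ - 1)) (Ioi Y) :=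
    (integrableOn_Ioi_rpow_of_lt (by linarith) hY).const_mul E
  set I := ∫ y in Ioi Y, E * y ^ (-δ - 1) with hI
  have hI0 : 0 ≤ I := setIntegral_nonneg measurableSet_Ioi fun y hy =>
    mul_nonneg hE0 (Real.rpow_nonneg (hY.trans hy).le _)
  refine ⟨Y, θ - 1, |κ| * |Z| * (Q * D + I), hY, by linarith, by positivity, ?_⟩
  intro z hz hres
  have hz0 : 0 < z := ha.trans_le hz.1
  have hzY : 1 / z ≤ Y := (one_div_le_one_div_of_le ha hz.1).trans haY
  have hosc (l φ : ℝ) (hl : l ≠ 0) :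
      HasTailBound Y (fun y => y ^ (-δ) * Real.cos (l * y + φ)) (D * |l| ^ (θ - 1)) :=
    ⟨ContinuousOn.mul (fun y hy => (Real.continuousAt_rpow_const y _
      (Or.inl (ne_of_gt hy))).continuousWithinAt) (by fun_prop), (hD l φ hl).1, (hD l φ hl).2⟩
  set p : ℝ → ℝ := fun y => R₁ * Real.cos (t * y + φ₁) * (R₂ * Real.cos (x * y + φ₂)) *
    (R₂ * Real.cos (z * y + φ₂)) with hp
  set w : ℝ → ℝ := fun y =>
    besselWave (α + β) (t * y) * besselWave α (x * y) * besselWave α (z * y) with hw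
  have hmain := (((((hosc (t + x + z) (φ₁ + φ₂ + φ₂) hres.1).add hY
    (hosc (t + x - z) (φ₁ + φ₂ - φ₂) hres.2.1)).add hY
    (hosc (t - x + z) (φ₁ - φ₂ + φ₂) hres.2.2.1)).add hY
    (hosc (t - x - z) (φ₁ - φ₂ - φ₂) hres.2.2.2)).const_mul (R₁ * R₂ * R₂ * (1 / 4)))
  have hwcont : ContinuousOn w (Ioi 0) := by
    have hs (ν s : ℝ) (hν : -1 < ν) (hs : 0 < s) :
        ContinuousOn (fun y => besselWave ν (s * y)) (Ioi 0) :=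
      (continuousOn_besselWave hν).comp (by fun_prop) fun y hy => mul_pos hs hy
    exact ((hs _ t hαβ' ht).mul (hs _ x hα hx)).mul (hs _ z hα hz0)
  have hscale (A s c y : ℝ) (hs : 0 < s) (hc : 0 < c) (hcs : c ≤ s) (hA : 0 ≤ A) (hy : 0 < y) :
      A / (s * y) ≤ A / c * y⁻¹ := by
    rw [← div_eq_mul_inv, div_div]
    gcongr
  have herr : HasTailBound Y (fun y => y ^ (-δ) * (w y - p y)) I := by
    refine HasTailBound.of_abs_le hY ?_ hGint fun y hy => ?_
    · exact ContinuousOn.mul (fun y hy => (Real.continuousAt_rpow_const y _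
        (Or.inl (ne_of_gt hy))).continuousWithinAt) (hwcont.sub (by fun_prop))
    · have hy0 : 0 < y := hY.trans hy
      have hcos (R u : ℝ) : |R * Real.cos u| ≤ |R| := by
        rw [abs_mul]
        exact mul_le_of_le_one_right (abs_nonneg _) (Real.abs_cos_le_one _)
      have key : |w y - p y| ≤ C₁ / t * y⁻¹ * P * P + |R₁| * (C₂ / x * y⁻¹) * P +
          |R₁| * P * (C₂ / a * y⁻¹) := by
        refine abs_mul_mul_sub_le ?_ ?_ (hcos _ _) ?_ ?_ ?_ ?_
        · exact (hB _ (hge x y hx hxY hy)).trans (by linarith [abs_nonneg R₂])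
        · exact (hB _ (hge z y hz0 hzY hy)).trans (by linarith [abs_nonneg R₂])
        · exact (hcos _ _).trans (by linarith)
        · exact (h₁ _ (hge t y ht htY hy)).trans (hscale _ _ _ _ ht ht le_rfl hC₁ hy0)
        · exact (h₂ _ (hge x y hx hxY hy)).trans (hscale _ _ _ _ hx hx le_rfl hC₂ hy0)
        · exact (h₂ _ (hge z y hz0 hzY hy)).trans (hscale _ _ _ _ hz0 ha hz.1 hC₂ hy0)
      rw [abs_mul, abs_of_pos (Real.rpow_pos_of_pos hy0 _), Real.rpow_sub_one hy0.ne']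
      calc y ^ (-δ) * |w y - p y| ≤ y ^ (-δ) * (C₁ / t * y⁻¹ * P * P +
            |R₁| * (C₂ / x * y⁻¹) * P + |R₁| * P * (C₂ / a * y⁻¹)) := by gcongr
        _ = _ := by
          rw [hE]
          ring
  refine HasTailBound.mono (((hmain.add hY herr).const_mul (κ * z ^ (-(α + 1 / 2)))).congr hY
    fun y hy => ?_) ?_
  · rw [weight_mul_tripleEntire ht hx hz0 hy, ← hδ]
    have hc := cos_mul_cos_mul_cos (t * y + φ₁) (x * y + φ₂) (z * y + φ₂)
    have e1 : t * y + φ₁ + (x * y + φ₂) + (z * y + φ₂) = (t + x + z) * y + (φ₁ + φ₂ + φ₂) := by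
      ring
    have e2 : t * y + φ₁ + (x * y + φ₂) - (z * y + φ₂) = (t + x - z) * y + (φ₁ + φ₂ - φ₂) := by
      ring
    have e3 : t * y + φ₁ - (x * y + φ₂) + (z * y + φ₂) = (t - x + z) * y + (φ₁ - φ₂ + φ₂) := by
      ring
    have e4 : t * y + φ₁ - (x * y + φ₂) - (z * y + φ₂) = (t - x - z) * y + (φ₁ - φ₂ - φ₂) := by
      ring
    rw [e1, e2, e3, e4] at hc
    simp only [hp, hw, hκ]
    linear_combination (t ^ (-δ) * x ^ (-(α + 1 / 2)) * z ^ (-(α + 1 / 2)) * y ^ (-δ) *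
      R₁ * R₂ * R₂) * hc
  · have hS0 : 0 ≤ resonanceWeight (θ - 1) t x z := by
      unfold resonanceWeight
      positivity
    have hz1 : |z ^ (-(α + 1 / 2))| ≤ |Z| := (hZ z hz).trans (le_abs_self Z)
    rw [abs_mul κ]
    calc |κ| * |z ^ (-(α + 1 / 2))| * (Q * (D * |t + x + z| ^ (θ - 1) +
          D * |t + x - z| ^ (θ - 1) + D * |t - x + z| ^ (θ - 1) + D * |t - x - z| ^ (θ - 1)) + I)
        = |κ| * |z ^ (-(α + 1 / 2))| * (Q * D * resonanceWeight (θ - 1) t x z + I) := by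
          rw [resonanceWeight]
          ring
      _ ≤ |κ| * |Z| * ((Q * D + I) * (1 + resonanceWeight (θ - 1) t x z)) := by
          have : Q * D * resonanceWeight (θ - 1) t x z + I ≤
              (Q * D + I) * (1 + resonanceWeight (θ - 1) t x z) := by
            have h1 : 0 ≤ Q * D := by positivity
            nlinarith [mul_nonneg hI0 hS0]
          have h2 : 0 ≤ Q * D * resonanceWeight (θ - 1) t x z + I := by positivity
          gcongr
      _ = _ := by ring

/-! ### Convergence and domination of the kernel -/

/-- The integral of the triple Bessel product over `(0, N]`. -/
noncomputable def truncatedTriple (α β t x N z : ℝ) : ℝ :=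
  ∫ y in Ioc 0 N, tripleEntire α β t x z y ∂(mu α)

lemma setIntegral_tripleBessel {α β t x z : ℝ} (ht : 0 < t) (hx : 0 < x) (hz : 0 < z) (N : ℝ) :
    ∫ y in Ioc 0 N, tripleBessel α β t x z y ∂(mu α) = truncatedTriple α β t x N z :=
  setIntegral_congr_fun measurableSet_Ioc fun _ hy =>
    tripleBessel_eq_tripleEntire ht hx hz hy.1

lemma setIntegral_mu_Ioc {E : Type*} [NormedAddCommGroup E] [NormedSpace ℝ E] (α N : ℝ)
    (g : ℝ → E) : ∫ y in Ioc 0 N, g y ∂(mu α) = ∫ y in Icc 0 N, g y ∂(mu α) := by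
  rw [← mu_restrict_Ioi, Measure.restrict_restrict measurableSet_Ioc,
    Measure.restrict_restrict measurableSet_Icc]
  congr 2
  ext y
  simp only [mem_inter_iff, mem_Ioc, mem_Icc, mem_Ioi]
  constructor
  · exact fun h => ⟨⟨h.2.le, h.1.2⟩, h.2⟩
  · exact fun h => ⟨⟨h.2, h.1.2⟩, h.2⟩

lemma integrableOn_Ioc_mu {E : Type*} [NormedAddCommGroup E] {α : ℝ} (hα : -1 < α) {g : ℝ → E}
    (hg : Continuous g) (N : ℝ) : IntegrableOn g (Ioc 0 N) (mu α) := by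
  have := isFiniteMeasureOnCompacts_mu hα
  exact (hg.continuousOn.integrableOn_compact isCompact_Icc).mono_set Ioc_subset_Icc_self

lemma continuous_tripleEntire_right {α β : ℝ} (hα : -1 < α) (hαβ : -1 < α + β) (t x z : ℝ) :
    Continuous (tripleEntire α β t x z) :=
  (continuous_tripleEntire hα hαβ t x).comp (Continuous.prodMk_right z)

lemma continuous_truncatedTriple {α β : ℝ} (hα : -1 < α) (hαβ : -1 < α + β) (t x N : ℝ) :
    Continuous (truncatedTriple α β t x N) := by
  have := isFiniteMeasureOnCompacts_mu hα
  simp only [funext fun z => show truncatedTriple α β t x N z =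
    ∫ y in Icc 0 N, tripleEntire α β t x z y ∂(mu α) from setIntegral_mu_Ioc _ _ _]
  exact continuous_parametric_integral_of_continuous (continuous_tripleEntire hα hαβ t x)
    isCompact_Icc

lemma truncatedTriple_eq_add {α β t x z Y N : ℝ} (hα : -1 < α) (hαβ : -1 < α + β)
    (hY : 0 < Y) (hN : Y ≤ N) :
    truncatedTriple α β t x N z = truncatedTriple α β t x Y z +
      ∫ y in Y..N, y ^ (2 * α + 1) * tripleEntire α β t x z y := by
  have hsub : Ioc Y N ⊆ Ioi 0 := fun y hy => hY.trans hy.1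
  have h := integrableOn_Ioc_mu hα (continuous_tripleEntire_right hα hαβ t x z) N
  rw [truncatedTriple, ← Ioc_union_Ioc_eq_Ioc hY.le hN,
    setIntegral_union (Ioc_disjoint_Ioc_of_le le_rfl) measurableSet_Ioc
      (h.mono_set (Ioc_subset_Ioc_right hN)) (h.mono_set (Ioc_subset_Ioc_left hY.le)),
    setIntegral_mu measurableSet_Ioc hsub, intervalIntegral.integral_of_le hN, truncatedTriple]
  rfl

/-- Off the resonances the truncated integrals of the triple product converge, and they are
dominated by a function of `z` which is locally integrable. -/
lemma exists_truncatedTriple_bound {α β t x a b : ℝ} (hα : -1 < α)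
    (hαβ : -(1 / 2 : ℝ) < α + β) (ht : 0 < t) (hx : 0 < x) (ha : 0 < a) :
    ∃ Y r C : ℝ, -1 < r ∧ ∀ z ∈ Icc a b, NonResonant t x z →
      (∃ L, Tendsto (fun N => truncatedTriple α β t x N z) atTop (𝓝 L)) ∧
      ∀ N, Y ≤ N → |truncatedTriple α β t x N z| ≤ C * (1 + resonanceWeight r t x z) := by
  have hαβ' : -1 < α + β := by linarith
  obtain ⟨Y, r, C, hY, hr, hC, h⟩ :=
    exists_hasTailBound_tripleEntire (b := b) hα hαβ ht hx ha
  obtain ⟨B, hB⟩ := isCompact_Icc.exists_bound_of_continuousOn (s := Icc a b)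
    (continuous_truncatedTriple hα hαβ' t x Y).continuousOn
  refine ⟨Y, r, |B| + C, hr, fun z hz hres => ?_⟩
  have htail := h z hz hres
  refine ⟨?_, fun N hN => ?_⟩
  · obtain ⟨L, hL⟩ := htail.exists_tendsto
    refine ⟨truncatedTriple α β t x Y z + L, (hL.const_add _).congr' ?_⟩
    filter_upwards [eventually_ge_atTop Y] with N hN
    exact (truncatedTriple_eq_add hα hαβ' hY hN).symm
  · rw [truncatedTriple_eq_add hα hαβ' hY hN]
    have h1 := (hB z hz).trans (le_abs_self B)
    rw [Real.norm_eq_abs] at h1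
    have h2 := htail.bound N hN
    have h3 : 0 ≤ resonanceWeight r t x z := by
      unfold resonanceWeight
      positivity
    have h4 : |B| ≤ |B| * (1 + resonanceWeight r t x z) :=
      le_mul_of_one_le_right (abs_nonneg B) (by linarith)
    rw [add_mul]
    exact (abs_add_le _ _).trans (by linarith)

lemma exists_hasTripleIntegral {α β t x z : ℝ} (hα : -1 < α)
    (hαβ : -(1 / 2 : ℝ) < α + β) (ht : 0 < t) (hx : 0 < x) (hz : 0 < z)
    (hres : NonResonant t x z) : ∃ l, HasTripleIntegral α β t x z l := by
  obtain ⟨Y, r, C, -, h⟩ := exists_truncatedTriple_bound (b := z) hα hαβ ht hx hz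
  obtain ⟨L, hL⟩ := (h z ⟨le_rfl, le_rfl⟩ hres).1
  refine ⟨L, fun N => ?_, ?_⟩
  · refine (integrableOn_Ioc_mu hα
      (continuous_tripleEntire_right hα (show -1 < α + β by linarith) t x z) N).congr_fun ?_
      measurableSet_Ioc
    exact fun y hy => (tripleBessel_eq_tripleEntire ht hx hz hy.1).symm
  · simpa only [setIntegral_tripleBessel ht hx hz] using hL

lemma kernel_eq_of_tendsto {α β t x z L : ℝ} (ht : 0 < t) (hx : 0 < x) (hz : 0 < z)
    (hL : Tendsto (fun N => truncatedTriple α β t x N z) atTop (𝓝 L)) :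
    kernel α β t x z = (2 : ℝ) ^ (α + β) * Real.Gamma (α + β + 1) * L := by
  simp only [kernel, setIntegral_tripleBessel ht hx hz]
  rw [hL.limUnder_eq]

/-- Dominated convergence for the truncated kernels, integrated against a function compactly
supported in the half-line. -/
lemma integrable_kernel_smul_and_tendsto {α β t x : ℝ} (hα : -1 < α)
    (hαβ : -(1 / 2 : ℝ) < α + β) (ht : 0 < t) (hx : 0 < x) {F : ℝ → ℂ} (hF : Continuous F)
    (hFc : HasCompactSupport F) (hF0 : tsupport F ⊆ Ioi 0) :
    Integrable (fun z => kernel α β t x z • F z) ∧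
      Tendsto (fun N => ∫ z, ((2 : ℝ) ^ (α + β) * Real.Gamma (α + β + 1) *
        truncatedTriple α β t x N z) • F z) atTop (𝓝 (∫ z, kernel α β t x z • F z)) := by
  set c := (2 : ℝ) ^ (α + β) * Real.Gamma (α + β + 1)
  obtain ⟨a, b, ha, hab⟩ := exists_tsupport_subset_Icc hFc hF0
  obtain ⟨Y, r, C, hr, h⟩ := exists_truncatedTriple_bound (b := b) hα hαβ ht hx ha
  set G : ℝ → ℝ := fun z => |c| * ((C * (1 + resonanceWeight r t x z)) * ‖F z‖) with hG
  have hGint : Integrable G := by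
    have hl : LocallyIntegrable fun z => C * (1 + resonanceWeight r t x z) :=
      ((locallyIntegrable_const (1 : ℝ)).add (locallyIntegrable_resonanceWeight hr t x)).smul C
    exact (hl.integrable_smul_right_of_hasCompactSupport hF.norm hFc.norm).const_mul |c|
  have hmeas (N : ℝ) :
      AEStronglyMeasurable (fun z => (c * truncatedTriple α β t x N z) • F z) volume :=
    ((continuous_const.mul (continuous_truncatedTriple hα (by linarith) t x N)).smul
      hF).aestronglyMeasurable
  have hbound (N : ℝ) (hN : Y ≤ N) :
      ∀ᵐ z, ‖(c * truncatedTriple α β t x N z) • F z‖ ≤ G z := by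
    filter_upwards [ae_nonResonant t x] with z hz
    rw [norm_smul, Real.norm_eq_abs, abs_mul, mul_assoc]
    by_cases hzs : z ∈ tsupport F
    · have := (h z (hab hzs) hz).2 N hN
      simp only [hG]
      gcongr
    · simp [hG, image_eq_zero_of_notMem_tsupport hzs]
  have hlim : ∀ᵐ z, Tendsto (fun N => (c * truncatedTriple α β t x N z) • F z) atTop
      (𝓝 (kernel α β t x z • F z)) := by
    filter_upwards [ae_nonResonant t x] with z hz
    by_cases hzs : z ∈ tsupport F
    · obtain ⟨L, hL⟩ := (h z (hab hzs) hz).1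
      rw [kernel_eq_of_tendsto ht hx (hF0 hzs) hL]
      exact (hL.const_mul c).smul_const _
    · simp [image_eq_zero_of_notMem_tsupport hzs]
  refine ⟨hGint.mono' (aestronglyMeasurable_of_tendsto_ae atTop hmeas hlim) ?_,
    tendsto_integral_filter_of_dominated_convergence G (Eventually.of_forall hmeas)
      ((eventually_ge_atTop Y).mono hbound) hGint hlim⟩
  have hb : ∀ᵐ z, ∀ n : ℕ, ‖(c * truncatedTriple α β t x (Y + n) z) • F z‖ ≤ G z :=
    ae_all_iff.2 fun n => hbound _ (by simp)
  filter_upwards [hb, hlim] with z hz hl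
  have hn : Tendsto (fun n : ℕ => Y + (n : ℝ)) atTop atTop :=
    tendsto_atTop_add_const_left _ _ tendsto_natCast_atTop_atTop
  exact le_of_tendsto (hl.comp hn).norm (Eventually.of_forall hz)

/-! ### Decay of the Hankel transform of a test function -/

/-- The Hankel transform of `f` at `y`, as an integral of entire functions of `y`. -/
noncomputable def hankelEntire (α : ℝ) (f : ℝ → ℂ) (y : ℝ) : ℂ :=
  ∫ z, besselEntire α (y * z) • (z ^ (2 * α + 1) • f z)

lemma hankel_eq_hankelEntire {α : ℝ} {f : ℝ → ℂ} (hf : IsTestFunction f) {y : ℝ} (hy : 0 < y) :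
    hankel α f y = hankelEntire α f y := by
  rw [hankelEntire, ← integral_smul_mu hf.2.2, hankel]
  refine integral_congr_ae ((ae_mu_pos α).mono fun z hz => ?_)
  simp only
  rw [besselQuot_eq_besselEntire _ (mul_pos hy hz)]

lemma hankelConverges_of_isTestFunction {α : ℝ} (hα : -1 < α) {f : ℝ → ℂ}
    (hf : IsTestFunction f) : HankelConverges α f := by
  intro x hx
  have hb := continuous_besselEntire hα
  have h := integrable_smul_mu hf.1.continuous hf.2.1 hf.2.2 α
    (g := fun y => besselEntire α (x * y)) (by fun_prop : Continuous _).locallyIntegrable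
  refine h.congr ((ae_mu_pos α).mono fun z hz => ?_)
  simp only
  rw [besselQuot_eq_besselEntire _ (mul_pos hx hz)]

lemma continuous_hankelEntire {α : ℝ} (hα : -1 < α) {f : ℝ → ℂ} (hf : IsTestFunction f) :
    Continuous (hankelEntire α f) := by
  have hb := continuous_besselEntire hα
  have hF := continuous_rpow_smul hf.1.continuous hf.2.2 (2 * α + 1)
  have e : hankelEntire α f = fun y =>
      ∫ z in tsupport f, besselEntire α (y * z) • (z ^ (2 * α + 1) • f z) := by
    funext y
    rw [hankelEntire, setIntegral_eq_integral_of_forall_compl_eq_zero]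
    intro z hz
    rw [image_eq_zero_of_notMem_tsupport hz, smul_zero, smul_zero]
  rw [e]
  refine continuous_parametric_integral_of_continuous ?_ hf.2.1.isCompact
  exact (hb.comp (continuous_fst.mul continuous_snd)).smul (hF.comp continuous_snd)

/-- Integration by parts with the primitive `z^(2α+2) J_{α+1}(yz) / (yz)^(α+1)` of
`z^(2α+1) J_α(yz) / (yz)^α`. -/
lemma hankelEntire_eq_neg_integral_deriv {α : ℝ} (hα : -1 < α) {f : ℝ → ℂ}
    (hf : IsTestFunction f) (y : ℝ) : hankelEntire α f y =
      -∫ z, besselEntire (α + 1) (y * z) • (z ^ (2 * α + 2) • deriv f z) := by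
  have hb := continuous_besselEntire hα
  have hb1 := continuous_besselEntire (show -1 < α + 1 by linarith)
  have hdc : HasCompactSupport (deriv f) := hf.2.1.deriv
  have hd0 : tsupport (deriv f) ⊆ Ioi 0 := tsupport_deriv_subset.trans
    hf.2.2
  have hdcont : Continuous (deriv f) := hf.1.continuous_deriv (by simp)
  have hi {g : ℝ → ℝ} {h : ℝ → ℂ} (q : ℝ) (hg : Continuous g) (hh : Continuous h)
      (hc : HasCompactSupport h) (h0 : tsupport h ⊆ Ioi 0) :
      Integrable fun z => g z • (z ^ q • h z) :=
    hg.locallyIntegrable.integrable_smul_right_of_hasCompactSupport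
      (continuous_rpow_smul hh h0 q) (hasCompactSupport_rpow_smul hc q)
  have hi1 := hi (g := fun z => besselEntire α (y * z)) (2 * α + 1) (by fun_prop)
    hf.1.continuous hf.2.1 hf.2.2
  have hi2 := hi (g := fun z => besselEntire (α + 1) (y * z)) (2 * α + 2) (by fun_prop)
    hdcont hdc hd0
  have hi3 := hi (g := fun z => besselEntire (α + 1) (y * z)) (2 * α + 2) (by fun_prop)
    hf.1.continuous hf.2.1 hf.2.2
  have key := integral_eq_zero_of_hasDerivAt_of_integrable
    (f := fun z => besselEntire (α + 1) (y * z) • (z ^ (2 * α + 2) • f z))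
    (f' := fun z => besselEntire α (y * z) • (z ^ (2 * α + 1) • f z) +
      besselEntire (α + 1) (y * z) • (z ^ (2 * α + 2) • deriv f z)) ?_ (hi1.add hi2) hi3
  · rw [integral_add hi1 hi2] at key
    exact eq_neg_of_add_eq_zero_left key
  intro z
  by_cases hz : z ∈ tsupport f
  · have hz0 : 0 < z := hf.2.2 hz
    have h1 := (hasDerivAt_besselEntire (show -1 < α + 1 by linarith) (y * z)).comp z
      ((hasDerivAt_id z).const_mul y)
    have h2 := Real.hasDerivAt_rpow_const (x := z) (p := 2 * α + 2) (Or.inl hz0.ne')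
    have h3 := (hf.1.differentiable (by simp)).differentiableAt (x := z) |>.hasDerivAt
    have h := h1.smul (h2.smul h3)
    refine h.congr_deriv ?_
    have hr := besselEntire_recurrence hα (y * z)
    have e1 : z ^ (2 * α + 2) = z * z ^ (2 * α + 1) := by
      rw [show 2 * α + 2 = 2 * α + 1 + 1 by ring, Real.rpow_add_one hz0.ne', mul_comm]
    have e2 : 2 * α + 2 - 1 = 2 * α + 1 := by ring
    have e3 : α + 1 + 1 = α + 2 := by ring
    simp only [Function.comp, Pi.smul_apply', Complex.real_smul, e2, e1, e3, hr]
    push_cast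
    ring
  · have hf0 := notMem_tsupport_iff_eventuallyEq.1 hz
    have hd : deriv f z = 0 := by
      rw [hf0.deriv_eq]
      simp
    have hz' : f z = 0 := hf0.self_of_nhds
    refine (HasDerivAt.congr_of_eventuallyEq (hasDerivAt_const z (0 : ℂ)) ?_).congr_deriv ?_
    · filter_upwards [hf0] with w hw
      simp [hw]
    · simp [hd, hz']

lemma exists_hankelEntire_bound {α : ℝ} (hα : -1 < α) {f : ℝ → ℂ} (hf : IsTestFunction f) :
    ∃ Y C : ℝ, 0 < Y ∧ 0 ≤ C ∧ ∀ y, Y ≤ y → ‖hankelEntire α f y‖ ≤ C * y ^ (-(α + 3 / 2)) := by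
  obtain ⟨a, b, ha, hab⟩ := exists_tsupport_subset_Icc hf.2.1 hf.2.2
  obtain ⟨B, hB0, hB⟩ := exists_besselEntire_bound (show -1 < α + 1 by linarith)
  have hdc : HasCompactSupport (deriv f) := hf.2.1.deriv
  have hsub : tsupport (deriv f) ⊆ tsupport f :=
    tsupport_deriv_subset
  have hdcont : Continuous (deriv f) := hf.1.continuous_deriv (by simp)
  set q := -(α + 3 / 2) + (2 * α + 2) with hq
  have hint : Integrable fun z : ℝ => ‖z ^ q • deriv f z‖ :=
    ((continuous_rpow_smul hdcont (hsub.trans hf.2.2) q).integrable_of_hasCompactSupport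
      (hasCompactSupport_rpow_smul hdc q)).norm
  refine ⟨1 / a, B * ∫ z, ‖z ^ q • deriv f z‖, by positivity,
    mul_nonneg hB0 (integral_nonneg fun z => norm_nonneg _), fun y hy => ?_⟩
  have hy0 : 0 < y := (by positivity : 0 < 1 / a).trans_le hy
  rw [hankelEntire_eq_neg_integral_deriv hα hf, norm_neg]
  calc ‖∫ z, besselEntire (α + 1) (y * z) • (z ^ (2 * α + 2) • deriv f z)‖
      ≤ ∫ z, B * y ^ (-(α + 3 / 2)) * ‖z ^ q • deriv f z‖ := by
        refine norm_integral_le_of_norm_le (hint.const_mul _) (ae_of_all _ fun z => ?_)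
        by_cases hz : z ∈ tsupport f
        · have hza := (hab hz).1
          have hz0 : 0 < z := ha.trans_le hza
          have h1 : 1 ≤ y * z := by
            have := (div_le_iff₀ ha).1 hy
            nlinarith
          have h2 := hB (y * z) h1
          have hqz : z ^ q = z ^ (-(α + 3 / 2)) * z ^ (2 * α + 2) := by
            rw [hq, Real.rpow_add hz0]
          rw [show α + 1 + 1 / 2 = α + 3 / 2 by ring, Real.mul_rpow hy0.le hz0.le] at h2
          rw [norm_smul, norm_smul, norm_smul, Real.norm_eq_abs, Real.norm_eq_abs,
            Real.norm_eq_abs, abs_of_pos (Real.rpow_pos_of_pos hz0 _),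
            abs_of_pos (Real.rpow_pos_of_pos hz0 _), hqz]
          calc _ ≤ B * (y ^ (-(α + 3 / 2)) * z ^ (-(α + 3 / 2))) *
                (z ^ (2 * α + 2) * ‖deriv f z‖) := by gcongr
            _ = _ := by ring
        · have : deriv f z = 0 := image_eq_zero_of_notMem_tsupport fun h => hz (hsub h)
          simp [this]
    _ = _ := by
        rw [integral_const_mul]
        ring

/-! ### The multiplier operator as an integral operator -/

/-- The integrand of the outer Hankel transform in the multiplier operator, continued to all real
arguments. -/
noncomputable def outerIntegrand (α β t : ℝ) (f : ℝ → ℂ) (x y : ℝ) : ℂ :=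
  ((2 : ℝ) ^ (α + β) * Real.Gamma (α + β + 1) *
    (besselEntire (α + β) (t * y) * besselEntire α (x * y))) • hankelEntire α f y

lemma besselQuot_smul_multHankel {α β t x y : ℝ} {f : ℝ → ℂ} (hf : IsTestFunction f) (ht : 0 < t)
    (hx : 0 < x) (hy : 0 < y) :
    besselQuot α (x * y) • multHankel α β t f y = outerIntegrand α β t f x y := by
  rw [multHankel, outerIntegrand, hankel_eq_hankelEntire hf hy, multiplier,
    besselQuot_eq_besselEntire _ (mul_pos hx hy), besselQuot_eq_besselEntire _ (mul_pos ht hy),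
    smul_smul]
  congr 1
  ring

lemma integrable_outerIntegrand {α β t x : ℝ} (hα : -1 < α) (hαβ : -(1 / 2 : ℝ) < α + β)
    (ht : 0 < t) (hx : 0 < x) {f : ℝ → ℂ} (hf : IsTestFunction f) :
    Integrable (outerIntegrand α β t f x) (mu α) := by
  have hαβ' : -1 < α + β := by linarith
  obtain ⟨Y, C, hY, hC, h⟩ := exists_hankelEntire_bound hα hf
  obtain ⟨B₁, hB₁, h₁⟩ := exists_besselEntire_bound hαβ'
  obtain ⟨B₂, hB₂, h₂⟩ := exists_besselEntire_bound hα
  set c := (2 : ℝ) ^ (α + β) * Real.Gamma (α + β + 1)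
  have hcont : Continuous (outerIntegrand α β t f x) := by
    have c1 := continuous_besselEntire hα
    have c2 := continuous_besselEntire hαβ'
    have c3 := continuous_hankelEntire hα hf
    unfold outerIntegrand
    fun_prop
  set Z := max Y (max (1 / t) (1 / x)) with hZ
  have hZ0 : 0 < Z := hY.trans_le (le_max_left _ _)
  have hsub : Ioi Z ⊆ Ioi 0 := Ioi_subset_Ioi hZ0.le
  have htail : IntegrableOn (outerIntegrand α β t f x) (Ioi Z) (mu α) := by
    rw [integrableOn_mu_iff measurableSet_Ioi hsub]
    -- the powers of `y` add up to `2α+1 - (α+β+1/2) - (α+1/2) - (α+3/2) = -(α+β+1/2) - 1 < -1`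
    have hint : IntegrableOn (fun y : ℝ => (|c| * (B₁ * t ^ (-(α + β + 1 / 2)) *
        (B₂ * x ^ (-(α + 1 / 2)))) * C) * y ^ (-(α + β + 3 / 2))) (Ioi Z) :=
      (integrableOn_Ioi_rpow_of_lt (by linarith) hZ0).const_mul _
    refine hint.mono' ?_ ?_
    · refine ContinuousOn.aestronglyMeasurable (fun y hy => ?_) measurableSet_Ioi
      exact ((Real.continuousAt_rpow_const y _ (Or.inl (ne_of_gt (hsub hy)))).smul
        hcont.continuousAt).continuousWithinAt
    · refine (ae_restrict_mem measurableSet_Ioi).mono fun y hy => ?_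
      have hy0 : 0 < y := hsub hy
      have hyZ : Z ≤ y := le_of_lt hy
      have hge (s : ℝ) (hs : 0 < s) (hsZ : 1 / s ≤ Z) : 1 ≤ s * y := by
        have := (div_le_iff₀ hs).1 (hsZ.trans hyZ)
        linarith
      have k₁ := h₁ _ (hge t ht ((le_max_left _ _).trans (le_max_right _ _)))
      have k₂ := h₂ _ (hge x hx ((le_max_right _ _).trans (le_max_right _ _)))
      have k₃ := h y ((le_max_left _ _).trans hyZ)
      rw [Real.mul_rpow ht.le hy0.le] at k₁
      rw [Real.mul_rpow hx.le hy0.le] at k₂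
      rw [norm_smul, outerIntegrand, norm_smul, Real.norm_eq_abs, Real.norm_eq_abs, abs_mul,
        abs_mul (besselEntire _ _), abs_of_pos (Real.rpow_pos_of_pos hy0 _)]
      calc _ ≤ y ^ (2 * α + 1) * (|c| * ((B₁ * (t ^ (-(α + β + 1 / 2)) *
            y ^ (-(α + β + 1 / 2)))) * (B₂ * (x ^ (-(α + 1 / 2)) * y ^ (-(α + 1 / 2))))) *
            (C * y ^ (-(α + 3 / 2)))) := by gcongr
        _ = (|c| * (B₁ * t ^ (-(α + β + 1 / 2)) * (B₂ * x ^ (-(α + 1 / 2)))) * C) *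
            (y ^ (2 * α + 1) * y ^ (-(α + β + 1 / 2)) * y ^ (-(α + 1 / 2)) *
              y ^ (-(α + 3 / 2))) := by ring
        _ = _ := by
          rw [← Real.rpow_add hy0, ← Real.rpow_add hy0, ← Real.rpow_add hy0]
          congr 2
          ring
  have := (integrableOn_Ioc_mu hα hcont Z).union htail
  rwa [Ioc_union_Ioi_eq_Ioi hZ0.le, IntegrableOn, mu_restrict_Ioi] at this

/-- Fubini's theorem for the truncated outer integral. -/
lemma setIntegral_outerIntegrand {α β t x : ℝ} (hα : -1 < α) (hαβ : -1 < α + β) {f : ℝ → ℂ}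
    (hf : IsTestFunction f) (N : ℝ) :
    ∫ y in Ioc 0 N, outerIntegrand α β t f x y ∂(mu α) =
      ∫ z, ((2 : ℝ) ^ (α + β) * Real.Gamma (α + β + 1) * truncatedTriple α β t x N z) •
        (z ^ (2 * α + 1) • f z) := by
  have := isFiniteMeasureOnCompacts_mu hα
  set c := (2 : ℝ) ^ (α + β) * Real.Gamma (α + β + 1) with hc
  set H : ℝ → ℝ → ℂ := fun y z =>
    (c * tripleEntire α β t x z y) • (z ^ (2 * α + 1) • f z) with hH
  have hHcont : Continuous (Function.uncurry H) :=
    (continuous_const.mul ((continuous_tripleEntire hα hαβ t x).comp continuous_swap)).smul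
      ((continuous_rpow_smul hf.1.continuous hf.2.2 (2 * α + 1)).comp continuous_snd)
  have hHint : Integrable (Function.uncurry H) (((mu α).restrict (Ioc 0 N)).prod volume) := by
    have h1 : IntegrableOn (Function.uncurry H) (Icc 0 N ×ˢ tsupport f)
        ((mu α).prod volume) :=
      hHcont.continuousOn.integrableOn_compact (isCompact_Icc.prod hf.2.1.isCompact)
    have h2 : IntegrableOn (Function.uncurry H) (Ioc 0 N ×ˢ univ) ((mu α).prod volume) := by
      refine h1.of_forall_sdiff_eq_zero (measurableSet_Ioc.prod MeasurableSet.univ) ?_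
      rintro ⟨y, z⟩ ⟨h, h'⟩
      have hz : z ∉ tsupport f := fun hz => h' ⟨Ioc_subset_Icc_self h.1, hz⟩
      simp [Function.uncurry, hH, image_eq_zero_of_notMem_tsupport hz]
    rwa [IntegrableOn, ← Measure.prod_restrict, Measure.restrict_univ] at h2
  have e1 (y : ℝ) : outerIntegrand α β t f x y = ∫ z, H y z := by
    rw [outerIntegrand, hankelEntire, ← integral_smul]
    refine integral_congr_ae (ae_of_all _ fun z => ?_)
    simp only [hH]
    rw [smul_smul, tripleEntire, mul_comm z y]
    congr 1
    ring
  simp only [e1]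
  rw [integral_integral_swap hHint]
  refine integral_congr_ae (ae_of_all _ fun z => ?_)
  simp only [hH]
  rw [integral_smul_const, integral_const_mul, truncatedTriple]

lemma meanConvergesAt_of_isTestFunction {α β t x : ℝ} (hα : -1 < α)
    (hαβ : -(1 / 2 : ℝ) < α + β) (ht : 0 < t) (hx : 0 < x) {f : ℝ → ℂ}
    (hf : IsTestFunction f) : MeanConvergesAt α β t f x := by
  constructor
  · filter_upwards [ae_restrict_mem measurableSet_Ioi, ae_restrict_of_ae (ae_nonResonant t x)]
      with z hz hres
    exact exists_hasTripleIntegral hα hαβ ht hx hz hres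
  · rw [integrable_mu_iff]
    have h := (integrable_kernel_smul_and_tendsto hα hαβ ht hx
      (continuous_rpow_smul hf.1.continuous hf.2.2 (2 * α + 1))
      (hasCompactSupport_rpow_smul hf.2.1 _)
      ((tsupport_smul_subset_right _ _).trans hf.2.2)).1
    exact (h.congr (ae_of_all _ fun z => smul_comm _ _ _)).integrableOn

lemma meanMultiplier_eq_meanIntegral {α β t x : ℝ} (hα : -1 < α)
    (hαβ : -(1 / 2 : ℝ) < α + β) (ht : 0 < t) (hx : 0 < x) {f : ℝ → ℂ}
    (hf : IsTestFunction f) : meanMultiplier α β t f x = meanIntegral α β t f x := by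
  have hint := integrable_outerIntegrand hα hαβ ht hx hf
  have hU : ⋃ N : ℝ, Ioc 0 N = Ioi 0 := iUnion_Ioc_right 0
  have hleft : Tendsto (fun N => ∫ y in Ioc 0 N, outerIntegrand α β t f x y ∂(mu α)) atTop
      (𝓝 (meanMultiplier α β t f x)) := by
    have h := tendsto_setIntegral_of_monotone (μ := mu α) (s := fun N : ℝ => Ioc 0 N)
      (fun _ => measurableSet_Ioc) (fun _ _ h => Ioc_subset_Ioc_right h) hint.integrableOn
    rw [hU, mu_restrict_Ioi] at h
    convert h using 2
    exact integral_congr_ae ((ae_mu_pos α).mono fun y hy =>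
      besselQuot_smul_multHankel hf ht hx hy)
  have hright := (integrable_kernel_smul_and_tendsto hα hαβ ht hx
      (continuous_rpow_smul hf.1.continuous hf.2.2 (2 * α + 1))
      (hasCompactSupport_rpow_smul hf.2.1 _)
      ((tsupport_smul_subset_right _ _).trans hf.2.2)).2
  simp only [setIntegral_outerIntegrand hα (show -1 < α + β by linarith) hf] at hleft
  rw [tendsto_nhds_unique hleft hright, meanIntegral, integral_smul_mu hf.2.2]

end SphericalMeans

theorem proposition1p1 (α β : ℝ) (hα : -1 < α) (hαβ : -(1 / 2 : ℝ) < α + β)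
    (t : ℝ) (ht : 0 < t) :
    {f : ℝ → ℂ | SphericalMeans.IsTestFunction f} ⊆ SphericalMeans.domain α β t ∧
      ∀ f : ℝ → ℂ, SphericalMeans.IsTestFunction f →
        SphericalMeans.HankelConverges α f ∧
        SphericalMeans.HankelConverges α (SphericalMeans.multHankel α β t f) ∧
        ∀ x : ℝ, 0 < x →
          SphericalMeans.MeanConvergesAt α β t f x ∧
          SphericalMeans.meanMultiplier α β t f x = SphericalMeans.meanIntegral α β t f x := by
  refine ⟨fun f hf => ?_, fun f hf => ⟨SphericalMeans.hankelConverges_of_isTestFunction hα hf,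
    fun x hx => ?_, fun x hx => ⟨SphericalMeans.meanConvergesAt_of_isTestFunction hα hαβ ht hx hf,
      SphericalMeans.meanMultiplier_eq_meanIntegral hα hαβ ht hx hf⟩⟩⟩
  · exact (ae_restrict_mem measurableSet_Ioi).mono fun x hx =>
      SphericalMeans.meanConvergesAt_of_isTestFunction hα hαβ ht hx hf
  · exact (SphericalMeans.integrable_outerIntegrand hα hαβ ht hx hf).congr
      ((SphericalMeans.ae_mu_pos α).mono fun y hy =>
        (SphericalMeans.besselQuot_smul_multHankel hf ht hx hy).symm)
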